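/- Let $k\ge 3$ and let $G$ be a finite connected $k$-uniform hypergraph. (The edge set of $G$ is a set of $k$-element subsets of $V(G)$; the degree $d(x)$ of a vertex $x$ is the number of edges containing $x$; $G$ is connected if any two vertices are joined by a path.) The spectral radius $\rho(G)$ is the maximum modulus of the eigenvalues of the adjacency tensor of $G$, i.e. of those $\lambda\in\mathbb C$ for which there is a nonzero $x\in\mathbb C^{V(G)}$ with $$\sum_{i_2,\dots,i_k\in V(G)} a_{i i_2\cdots i_k}\,x_{i_2}\cdots x_{i_k}=\lambda x_i^{k-1}\qquad (i\in V(G)),$$ where $a_{i_1\cdots i_k}=\frac1{(k-1)!}$ if $\{i_1,\dots,i_k\}$ is an edge of $G$ and $a_{i_1\cdots i_k}=0$ otherwise. For vertices $u,v$ of $G$ and integers $p,q\ge 0$, let $G_{u,v}(p,q)$ be the $k$-uniform hypergraph obtained from $G$ by attaching a pendant path of length $p$ at $u$ and a pendant path of length $q$ at $v$. Here attaching a path of length $p$ at $u$ means adding new edges $e_1,\dots,e_p$ and $p(k-1)$ new vertices, including $u_1,\dots,u_p$, such that with $u_0=u$ each $e_i$ consists of $u_{i-1}$ and $k-1$ new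 vertices, among them $u_i$, the new vertices in different edges $e_i$ being chosen disjoint; for $p=0$ nothing is added. Let $e$ be a pendant edge of $G$, that is, an edge with one vertex of degree at least $2$ whose other vertices all have degree $1$, and let $u\ne v$ be two pendant vertices (vertices of degree $1$) in $e$. If $p\ge q\ge 1$, then $$\rho(G_{u,v}(p,q))>\rho(G_{u,v}(p+1,q-1)).$$ -/

import Mathlib

open scoped Hypergraph

noncomputable section

/-! ### Eigenvalues of tensors

A tensor of order `m + 1` and dimension `n` is a function `(Fin (m + 1) → ι) → ℂ`, where `ι` is a
finite type with `n` elements. -/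

/-- The vector `T x`, with components `∑_{i₂, …, i_{m+1}} T_{i i₂ … i_{m+1}} x_{i₂} ⋯ x_{i_{m+1}}`. -/
def tensorApply {ι : Type*} [Fintype ι] {m : ℕ} (T : (Fin (m + 1) → ι) → ℂ) (x : ι → ℂ)
    (i : ι) : ℂ :=
  ∑ g : Fin m → ι, T (Fin.cons i g) * ∏ j, x (g j)

/-- `l` is an eigenvalue of the tensor `T` of order `m + 1`: there is a nonzero complex vector `x`
with `T x = l x^[m]`, where `x^[m]` is the entrywise power. -/
def IsTensorEigenvalue {ι : Type*} [Fintype ι] {m : ℕ} (T : (Fin (m + 1) → ι) → ℂ) (l : ℂ) :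
    Prop :=
  ∃ x : ι → ℂ, x ≠ 0 ∧ ∀ i, tensorApply T x i = l * x i ^ m

/-- The spectral radius of a tensor: the maximum modulus of its eigenvalues. -/
def tensorSpectralRadius {ι : Type*} [Fintype ι] {m : ℕ} (T : (Fin (m + 1) → ι) → ℂ) : ℝ :=
  sSup {r : ℝ | ∃ l : ℂ, IsTensorEigenvalue T l ∧ ‖l‖ = r}

/-- As soon as there is an eigenvalue, the maximum in the definition of the spectral radius is
attained. -/
theorem isGreatest_tensorSpectralRadius {ι : Type*} [Fintype ι] {m : ℕ}
    (T : (Fin (m + 1) → ι) → ℂ) (hT : ∃ l, IsTensorEigenvalue T l) :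
    IsGreatest {r : ℝ | ∃ l : ℂ, IsTensorEigenvalue T l ∧ ‖l‖ = r} (tensorSpectralRadius T) := by
  set K : Set (ℂ × (ι → ℂ)) :=
    {z | ‖z.2‖ = 1 ∧ ∀ i, tensorApply T z.2 i = z.1 * z.2 i ^ m} with hK
  have himg : {r : ℝ | ∃ l : ℂ, IsTensorEigenvalue T l ∧ ‖l‖ = r} = (fun z => ‖z.1‖) '' K := by
    ext r
    constructor
    · rintro ⟨l, ⟨x, hx, h⟩, rfl⟩
      have hx' : ‖x‖ ≠ 0 := norm_ne_zero_iff.mpr hx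
      refine ⟨(l, ((‖x‖ : ℂ)⁻¹) • x), ⟨?_, ?_⟩, rfl⟩
      · rw [norm_smul, norm_inv, Complex.norm_real, norm_norm, inv_mul_cancel₀ hx']
      · intro i
        have : tensorApply T ((‖x‖ : ℂ)⁻¹ • x) i = ((‖x‖ : ℂ)⁻¹) ^ m * tensorApply T x i := by
          simp only [tensorApply, Finset.mul_sum, Pi.smul_apply, smul_eq_mul,
            Finset.prod_mul_distrib, Finset.prod_const, Finset.card_univ, Fintype.card_fin]
          exact Finset.sum_congr rfl fun g _ => by ring
        simp only [this, h i, Pi.smul_apply, smul_eq_mul]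
        ring
    · rintro ⟨⟨l, x⟩, ⟨h1, h2⟩, rfl⟩
      refine ⟨l, ⟨x, ?_, h2⟩, rfl⟩
      rintro rfl
      simp at h1
  have hclosed : IsClosed K := by
    have h1 : IsClosed {z : ℂ × (ι → ℂ) | ‖z.2‖ = 1} :=
      isClosed_eq (by fun_prop) continuous_const
    have h2 : IsClosed {z : ℂ × (ι → ℂ) | ∀ i, tensorApply T z.2 i = z.1 * z.2 i ^ m} := by
      simp only [Set.ofPred_forall]
      refine isClosed_iInter fun i => isClosed_eq ?_ (by fun_prop)
      unfold tensorApply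
      fun_prop
    exact h1.inter h2
  have hbdd : K ⊆ Metric.closedBall 0 (max (∑ f, ‖T f‖) 1) := by
    rintro ⟨l, x⟩ ⟨h1, h2⟩
    have h1 : ‖x‖ = 1 := h1
    have hne : Nonempty ι := by
      by_contra hι
      have : x = 0 := funext fun i => (hι ⟨i⟩).elim
      simp [this] at h1
    obtain ⟨i, hi⟩ := Finite.exists_max fun i => ‖x i‖
    have hxi : ‖x i‖ = 1 := le_antisymm (h1 ▸ norm_le_pi_norm x i)
      (h1 ▸ (pi_norm_le_iff_of_nonneg (norm_nonneg _)).mpr hi)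
    have hl : ‖l‖ ≤ ∑ f, ‖T f‖ := by
      have h3 : ‖l‖ = ‖tensorApply T x i‖ := by
        rw [h2 i, norm_mul, norm_pow]
        simp [hxi]
      rw [h3]
      calc ‖tensorApply T x i‖ ≤ ∑ g : Fin m → ι, ‖T (Fin.cons i g)‖ := by
            refine (norm_sum_le _ _).trans (Finset.sum_le_sum fun g _ => ?_)
            rw [norm_mul, norm_prod]
            refine mul_le_of_le_one_right (norm_nonneg _)
              (Finset.prod_le_one (fun _ _ => norm_nonneg _) fun j _ => ?_)
            exact h1 ▸ norm_le_pi_norm x (g j)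
        _ = ∑ f ∈ Finset.univ.map
              ⟨fun g : Fin m → ι => (Fin.cons i g : Fin (m + 1) → ι),
                Fin.cons_right_injective (α := fun _ => ι) i⟩, ‖T f‖ := by
            simp
        _ ≤ ∑ f, ‖T f‖ :=
            Finset.sum_le_sum_of_subset_of_nonneg (Finset.subset_univ _)
              fun _ _ _ => norm_nonneg _
    rw [mem_closedBall_zero_iff, Prod.norm_def]
    exact max_le (hl.trans (le_max_left _ _)) (h1.le.trans (le_max_right _ _))
  have hcomp : IsCompact K := (isCompact_closedBall _ _).of_isClosed_subset hclosed hbdd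
  have hS := hcomp.image (f := fun z : ℂ × (ι → ℂ) => ‖z.1‖) (by fun_prop)
  rw [← himg] at hS
  refine hS.isGreatest_sSup ?_
  obtain ⟨l, hl⟩ := hT
  exact ⟨‖l‖, l, hl, rfl⟩

namespace Hypergraph

/-! ### Uniform hypergraphs, degrees, paths -/

/-- Every edge has exactly `k` vertices. -/
def IsUniform {α : Type*} (H : Hypergraph α) (k : ℕ) : Prop :=
  ∀ e ∈ E(H), e.encard = k

/-- The degree of a vertex: the number of edges containing it. -/
def degree {α : Type*} (H : Hypergraph α) (v : α) : ℕ :=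
  {e | e ∈ E(H) ∧ v ∈ e}.ncard

/-- A pendant vertex is a vertex of degree one. -/
def IsPendantVertex {α : Type*} (H : Hypergraph α) (v : α) : Prop :=
  v ∈ V(H) ∧ H.degree v = 1

/-- The alternating sequence `(w 0, f 0, w 1, f 1, …, f (n - 1), w n)` is a path of length `n`:
all its vertices are distinct, all its edges are distinct, and each edge contains the vertices
before and after it. -/
def IsPath {α : Type*} (H : Hypergraph α) {n : ℕ} (w : Fin (n + 1) → α) (f : Fin n → Set α) :
    Prop :=
  (∀ i, w i ∈ V(H)) ∧ (∀ i, f i ∈ E(H)) ∧ Function.Injective w ∧ Function.Injective f ∧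
    ∀ i : Fin n, w i.castSucc ∈ f i ∧ w i.succ ∈ f i

/-- Any two vertices are joined by a path. -/
def IsConnected {α : Type*} (H : Hypergraph α) : Prop :=
  V(H).Nonempty ∧ ∀ x ∈ V(H), ∀ y ∈ V(H),
    ∃ (n : ℕ) (w : Fin (n + 1) → α) (f : Fin n → Set α),
      H.IsPath w f ∧ w 0 = x ∧ w (Fin.last n) = y

/-- A pendant edge: one of its vertices has degree at least two, and all its other vertices have
degree one. -/
def IsPendantEdge {α : Type*} (H : Hypergraph α) (e : Set α) : Prop :=
  e ∈ E(H) ∧ ∃ w ∈ e, 2 ≤ H.degree w ∧ ∀ x ∈ e, x ≠ w → H.degree x = 1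

/-! ### The adjacency tensor and the spectral radius -/

/-- The adjacency tensor of a `k`-uniform hypergraph. Its order is `k = k - 1 + 1` (for `1 ≤ k`),
its dimension is the number of vertices, and its entry at `(i₁, …, i_k)` is `1 / (k - 1)!` if
`{i₁, …, i_k}` is an edge and `0` otherwise. -/
def adjTensor {α : Type*} (H : Hypergraph α) (k : ℕ) (i : Fin (k - 1 + 1) → V(H)) : ℂ :=
  open scoped Classical in
  if Set.range (fun j => (i j : α)) ∈ E(H) then 1 / ((k - 1).factorial : ℂ) else 0

/-- The spectral radius of a (finite) `k`-uniform hypergraph: the maximum modulus of the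
eigenvalues of its adjacency tensor. -/
def spectralRadius {α : Type*} [Fintype α] (H : Hypergraph α) (k : ℕ) : ℝ :=
  open scoped Classical in
  tensorSpectralRadius (H.adjTensor k)

/-- For a nonempty `k`-uniform hypergraph with `3 ≤ k`, the spectral radius is indeed a maximum. -/
theorem isGreatest_spectralRadius {α : Type*} [Fintype α] (H : Hypergraph α) (k : ℕ) (hk : 3 ≤ k)
    (hH : H.IsUniform k) (hne : V(H).Nonempty) :
    open scoped Classical in
    IsGreatest {r : ℝ | ∃ l : ℂ, IsTensorEigenvalue (H.adjTensor k) l ∧ ‖l‖ = r}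
      (H.spectralRadius k) := by
  classical
  refine isGreatest_tensorSpectralRadius _ ⟨0, ?_⟩
  obtain ⟨a, ha⟩ := hne
  refine ⟨Pi.single ⟨a, ha⟩ 1, by simp, fun i => ?_⟩
  rw [zero_mul]
  refine Finset.sum_eq_zero fun g _ => ?_
  by_cases hg : ∀ j, g j = ⟨a, ha⟩
  · have hr : Set.range (fun j => ((Fin.cons i g : Fin (k - 1 + 1) → V(H)) j : α)) ⊆
        {(i : α), a} := by
      rintro _ ⟨j, rfl⟩
      refine Fin.cases ?_ (fun j => ?_) j
      · simp
      · simp [hg]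
    have : H.adjTensor k (Fin.cons i g) = 0 := by
      rw [adjTensor, if_neg]
      intro hE
      have h1 := (Set.encard_le_encard hr).trans (Set.encard_insert_le _ _)
      rw [hH _ hE, Set.encard_singleton, one_add_one_eq_two] at h1
      have : k ≤ 2 := by exact_mod_cast h1
      omega
    rw [this, zero_mul]
  · push Not at hg
    obtain ⟨j, hj⟩ := hg
    rw [Finset.prod_eq_zero (Finset.mem_univ j) (by simp [hj]), mul_zero]

/-! ### Attaching pendant paths -/

/-- The vertices of the `i`-th edge (`i = 0, …, p - 1`) of a path of length `p` attached at `u`: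
the `k - 1` new vertices `(i, 0), …, (i, k - 2)`, and the vertex shared with what precedes, which
is `u` if `i = 0` and the new vertex `(i - 1, 0)` of the preceding edge otherwise. -/
def attachedEdge {α : Type*} (k : ℕ) (u : α) (p : ℕ) (i : Fin p) :
    Set (α ⊕ Fin p × Fin (k - 1)) :=
  {x | (∃ j, x = Sum.inr (i, j)) ∨ ((i : ℕ) = 0 ∧ x = Sum.inl u) ∨
    ∃ (i' : Fin p) (j : Fin (k - 1)), (i' : ℕ) + 1 = i ∧ (j : ℕ) = 0 ∧ x = Sum.inr (i', j)}

/-- The hypergraph obtained from the `k`-uniform hypergraph `H` by attaching a pendant path of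
length `p` at the vertex `u`; for `p = 0` it is `H`, up to the names of the vertices. (For a vertex
`u` of `H`, the set `insert u V(H)` is just `V(H)`.) -/
def attachPath {α : Type*} (H : Hypergraph α) (k : ℕ) (u : α) (p : ℕ) :
    Hypergraph (α ⊕ Fin p × Fin (k - 1)) where
  vertexSet := Sum.inl '' insert u V(H) ∪ Set.range Sum.inr
  edgeSet := (fun e => Sum.inl '' e) '' E(H) ∪ Set.range (attachedEdge k u p)
  subset_vertexSet_of_mem_edgeSet' := by
    rintro _ (⟨e, he, rfl⟩ | ⟨i, rfl⟩)
    · exact (Set.image_mono ((H.subset_vertexSet_of_mem_edgeSet' he).trans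
        (Set.subset_insert _ _))).trans Set.subset_union_left
    · rintro x (⟨j, rfl⟩ | ⟨-, rfl⟩ | ⟨i', j, -, -, rfl⟩)
      · exact Or.inr ⟨_, rfl⟩
      · exact Or.inl ⟨u, Set.mem_insert _ _, rfl⟩
      · exact Or.inr ⟨_, rfl⟩

/-- The hypergraph `G_{u,v}(p,q)`: first attach a pendant path of length `p` at `u`, and then a
pendant path of length `q` at `v`. -/
def attachTwoPaths {α : Type*} (G : Hypergraph α) (k : ℕ) (u v : α) (p q : ℕ) :
    Hypergraph ((α ⊕ Fin p × Fin (k - 1)) ⊕ Fin q × Fin (k - 1)) :=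
  (G.attachPath k u p).attachPath k (Sum.inl v) q

end Hypergraph

end

/-!
Throughout, `incidentSum H x a` is the sum of the edge products `∏ b ∈ s, x b` over the edges `s`
through `a`, so that an eigenvector with eigenvalue `c` satisfies `incidentSum H x a = c * x a ^ k`.

The comparison rests on two facts about connected uniform hypergraphs. There is a positive
eigenvector (`exists_pos_eigenvector`), and a positive vector `y` with
`incidentSum H y ≤ c * y ^ k`, strict somewhere, forces the spectral radius below `c`
(`norm_lt_of_starSum_le`). Hence it suffices to turn a positive eigenvector of `G_{u,v}(p,q)`, with
eigenvalue `c`, into a vector of the second kind on `G_{u,v}(p+1,q-1)`.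

Along an attached path of length `n` the eigenvalue equation can be solved explicitly: the path
contributes the proportion `f n` of `c * x u ^ k` at the vertex `u` where it is attached, with
`f 0 = 0` and `f (n + 1) = c⁻ᵏ / (1 - f n)` (`pathWeight`, `pathEdgeProd_eq_of_eigenvector`,
`exists_extension_attachPath`). So everything takes place on `G`, with an eigenvalue equation in
which `c` is replaced by `c * (1 - f p)` at `u` and by `c * (1 - f q)` at `v`.

Let `w` be the vertex of the pendant edge `e` of degree at least two. Multiplying the equations at
the other vertices of `e` shows that `e` contributes the proportion
`c⁻ᵏ / ((1 - f p) * (1 - f q))` at `w`. Since `w` lies on another edge, this is less than one, that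
is, `f (p + 1) + f q < 1`; together with `f q < f (p + 1)` this yields
`(1 - f p) * (1 - f q) < (1 - f (p + 1)) * (1 - f (q - 1))` (`pathWeight_mul_lt`). Rescaling the
entries on `e` other than the one at `w` (`pendantScale`) solves the equations for the new path
lengths `p + 1` and `q - 1` at all vertices but `w`, where the contribution of `e` has become
smaller.
-/

/-! ### Spectral theory of finite uniform set families -/

/-- For a family `F` of finite sets and a vector `x`, the sum over the members `e` of `F` that
contain `i` of the products `∏ j ∈ e, x j`. If `F` is the edge set of a uniform hypergraph with
adjacency tensor `A`, this is `x i * (A x) i`; keeping the factor `x i` makes the formula symmetric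
in the vertices of an edge. -/
def starSum {ι R : Type*} [DecidableEq ι] [CommSemiring R] (F : Finset (Finset ι)) (x : ι → R)
    (i : ι) : R :=
  ∑ e ∈ F with i ∈ e, ∏ j ∈ e, x j

/-- A family of finite sets is connected if every nonempty set of vertices that contains each
member of the family it meets is everything. -/
def IsConnectedFamily {ι : Type*} (F : Finset (Finset ι)) : Prop :=
  ∀ S : Set ι, S.Nonempty → (∀ e ∈ F, ∀ i ∈ e, i ∈ S → ∀ j ∈ e, j ∈ S) → ∀ i, i ∈ S

lemma card_filter_image_cons_eq {ι : Type*} [Fintype ι] [DecidableEq ι] {m : ℕ} (s : Finset ι)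
    (hs : s.card = m + 1) {i : ι} (hi : i ∈ s) :
    (Finset.univ.filter fun g : Fin m → ι =>
      Finset.univ.image (Fin.cons i g : Fin (m + 1) → ι) = s).card = m.factorial := by
  have hce : (s.erase i).card = m := by rw [Finset.card_erase_of_mem hi, hs]; rfl
  have himg : ∀ g : Fin m → ι, Finset.univ.image (Fin.cons i g : Fin (m + 1) → ι) =
      insert i (Finset.univ.image g) := by
    intro g
    ext a
    simp [Fin.exists_fin_succ, eq_comm]
  have h1 : Fintype.card (Fin m ↪ ↥(s.erase i)) = m.factorial := by
    rw [Fintype.card_embedding_eq, Fintype.card_coe, hce, Fintype.card_fin,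
      Nat.descFactorial_self]
  rw [← h1, ← Finset.card_univ]
  symm
  refine Finset.card_bij (fun φ _ j => (φ j : ι)) ?_ ?_ ?_
  · intro φ _
    rw [Finset.mem_filter]
    refine ⟨Finset.mem_univ _, ?_⟩
    have h2 : Finset.univ.image (fun j => (φ j : ι)) = s.erase i := by
      refine Finset.eq_of_subset_of_card_le ?_ ?_
      · intro a ha
        obtain ⟨j, -, rfl⟩ := Finset.mem_image.1 ha
        exact (φ j).2
      · have h3 : Function.Injective fun j => (φ j : ι) := Subtype.val_injective.comp φ.injective
        rw [Finset.card_image_of_injective _ h3, hce, Finset.card_univ, Fintype.card_fin]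
    rw [himg, h2, Finset.insert_erase hi]
  · intro φ _ ψ _ h
    ext j
    exact congrFun h j
  · intro g hg
    have hg := (Finset.mem_filter.1 hg).2
    have hinj : Function.Injective (Fin.cons i g : Fin (m + 1) → ι) := by
      rw [← Set.injOn_univ, ← Finset.coe_univ, ← Finset.card_image_iff, hg, hs, Finset.card_univ,
        Fintype.card_fin]
    have hne : ∀ j, g j ≠ i := fun j h => by
      have := @hinj j.succ 0 (by simpa using h)
      exact absurd this (Fin.succ_ne_zero j)
    refine ⟨⟨fun j => ⟨g j, Finset.mem_erase.2 ⟨hne j, ?_⟩⟩, ?_⟩, Finset.mem_univ _, rfl⟩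
    · rw [← hg, himg]
      exact Finset.mem_insert_of_mem (Finset.mem_image_of_mem _ (Finset.mem_univ _))
    · intro a b hab
      have h3 : g a = g b := congrArg Subtype.val hab
      exact Fin.succ_injective _ (@hinj a.succ b.succ (by simpa using h3))

/-- For the adjacency tensor of a uniform family, the factor `1 / m!` cancels the number of
enumerations of the remaining `m` vertices of an edge through `i`. -/
lemma tensorApply_mul_eq_starSum {ι : Type*} [Fintype ι] [DecidableEq ι] {m : ℕ}
    {F : Finset (Finset ι)} (hF : ∀ s ∈ F, s.card = m + 1) {T : (Fin (m + 1) → ι) → ℂ}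
    (hT : ∀ f, T f = if Finset.univ.image f ∈ F then 1 / (m.factorial : ℂ) else 0)
    (x : ι → ℂ) (i : ι) : tensorApply T x i * x i = starSum F x i := by
  have h1 : ∀ g : Fin m → ι, T (Fin.cons i g) * (∏ j, x (g j)) * x i =
      ∑ s ∈ F with i ∈ s, if Finset.univ.image (Fin.cons i g : Fin (m + 1) → ι) = s then
        1 / (m.factorial : ℂ) * ∏ j ∈ s, x j else 0 := by
    intro g
    rw [Finset.sum_ite_eq, hT]
    have hi : i ∈ Finset.univ.image (Fin.cons i g : Fin (m + 1) → ι) :=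
      Finset.mem_image.2 ⟨0, Finset.mem_univ _, rfl⟩
    by_cases hs : Finset.univ.image (Fin.cons i g : Fin (m + 1) → ι) ∈ F
    · rw [if_pos hs, if_pos (Finset.mem_filter.2 ⟨hs, hi⟩), Finset.prod_image]
      · rw [Fin.prod_univ_succ]
        simp only [Fin.cons_zero, Fin.cons_succ]
        ring
      · rw [← Finset.card_image_iff, hF _ hs]
        simp
    · rw [if_neg hs, if_neg fun h => hs (Finset.mem_filter.1 h).1]
      ring
  unfold tensorApply
  rw [Finset.sum_mul, Finset.sum_congr rfl fun g _ => h1 g, Finset.sum_comm, starSum]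
  refine Finset.sum_congr rfl fun s hs => ?_
  obtain ⟨hs, hi⟩ := Finset.mem_filter.1 hs
  rw [← Finset.sum_filter, Finset.sum_const, card_filter_image_cons_eq s (hF s hs) hi,
    nsmul_eq_mul, ← mul_assoc, mul_one_div_cancel (by exact_mod_cast m.factorial_ne_zero), one_mul]

section Family

variable {ι : Type*} [DecidableEq ι] {F : Finset (Finset ι)} {k : ℕ}

lemma starSum_smul {R : Type*} [CommSemiring R] (hF : ∀ e ∈ F, e.card = k) (t : R) (x : ι → R)
    (i : ι) : starSum F (fun j => t * x j) i = t ^ k * starSum F x i := by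
  simp only [starSum, Finset.mul_sum]
  refine Finset.sum_congr rfl fun e he => ?_
  rw [Finset.prod_mul_distrib, Finset.prod_const, hF e (Finset.mem_filter.1 he).1]

lemma starSum_nonneg {x : ι → ℝ} (hx : ∀ i, 0 ≤ x i) (i : ι) : 0 ≤ starSum F x i :=
  Finset.sum_nonneg fun _ _ => Finset.prod_nonneg fun j _ => hx j

lemma starSum_mono {x y : ι → ℝ} (hx : ∀ i, 0 ≤ x i) (hxy : ∀ i, x i ≤ y i) (i : ι) :
    starSum F x i ≤ starSum F y i :=
  Finset.sum_le_sum fun _ _ => Finset.prod_le_prod (fun j _ => hx j) fun j _ => hxy j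

lemma starSum_lt_starSum {x y : ι → ℝ} (hx : ∀ i, 0 ≤ x i) (hy : ∀ i, 0 < y i)
    (hxy : ∀ i, x i ≤ y i) {e : Finset ι} (he : e ∈ F) {i j : ι} (hi : i ∈ e) (hj : j ∈ e)
    (hlt : x j < y j) : starSum F x i < starSum F y i := by
  refine Finset.sum_lt_sum
    (fun _ _ => Finset.prod_le_prod (fun j _ => hx j) fun j _ => hxy j)
    ⟨e, Finset.mem_filter.2 ⟨he, hi⟩, ?_⟩
  rw [← Finset.mul_prod_erase _ _ hj, ← Finset.mul_prod_erase _ y hj]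
  calc x j * ∏ l ∈ e.erase j, x l ≤ x j * ∏ l ∈ e.erase j, y l :=
        mul_le_mul_of_nonneg_left
          (Finset.prod_le_prod (fun j _ => hx j) fun j _ => hxy j) (hx j)
    _ < y j * ∏ l ∈ e.erase j, y l :=
        mul_lt_mul_of_pos_right hlt (Finset.prod_pos fun l _ => hy l)

lemma prod_le_starSum {x : ι → ℝ} (hx : ∀ i, 0 ≤ x i) {e : Finset ι} (he : e ∈ F) {i : ι}
    (hi : i ∈ e) : ∏ j ∈ e, x j ≤ starSum F x i :=
  Finset.single_le_sum (f := fun e => ∏ j ∈ e, x j)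
    (fun _ _ => Finset.prod_nonneg fun j _ => hx j) (Finset.mem_filter.2 ⟨he, hi⟩)

/-- A Harnack inequality: along an edge `e` through `i` one has
`y j ≤ ∏ l ∈ e, y l ≤ c * y i ^ k` whenever all entries of `y` are at least one. -/
lemma exists_harnack_bound (hconn : IsConnectedFamily F) {c : ℝ} (hc : 0 ≤ c) (i₀ j : ι) :
    ∃ M : ℝ, ∀ y : ι → ℝ, (∀ i, 1 ≤ y i) → (∀ i, starSum F y i ≤ c * y i ^ k) → y i₀ = 1 →
      y j ≤ M := by
  refine hconn {j | ∃ M : ℝ, ∀ y : ι → ℝ, (∀ i, 1 ≤ y i) →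
    (∀ i, starSum F y i ≤ c * y i ^ k) → y i₀ = 1 → y j ≤ M} ⟨i₀, 1, fun y _ _ h => h.le⟩ ?_ j
  rintro e he i hi ⟨M, hM⟩ j hj
  refine ⟨c * M ^ k, fun y hy1 hy2 hy3 => ?_⟩
  have hpos : ∀ i, 0 ≤ y i := fun i => zero_le_one.trans (hy1 i)
  calc y j ≤ ∏ l ∈ e, y l := by
        rw [← Finset.mul_prod_erase _ _ hj]
        exact le_mul_of_one_le_right (hpos j) (Finset.one_le_prod fun l _ => hy1 l)
    _ ≤ starSum F y i := prod_le_starSum hpos he hi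
    _ ≤ c * y i ^ k := hy2 i
    _ ≤ c * M ^ k :=
        mul_le_mul_of_nonneg_left (pow_le_pow_left₀ (hpos i) (hM y hy1 hy2 hy3) k) hc

/-- The infimum of the `c` that admit a positive vector `y` with `starSum F y ≤ c * y ^ k` is
attained: the Harnack bound confines the normalized vectors to a compact set. -/
lemma exists_minimal_superharmonic [Fintype ι] [Nonempty ι] (hF : ∀ e ∈ F, e.card = k)
    (hconn : IsConnectedFamily F) :
    ∃ c : ℝ, (∃ y : ι → ℝ, (∀ i, 0 < y i) ∧ ∀ i, starSum F y i ≤ c * y i ^ k) ∧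
      ∀ c' : ℝ, 0 ≤ c' → ∀ y : ι → ℝ, (∀ i, 0 < y i) → (∀ i, starSum F y i ≤ c' * y i ^ k) →
        c ≤ c' := by
  set c₀ : ℝ := ∑ i, starSum F (fun _ => (1 : ℝ)) i with hc₀
  have hnn : ∀ i, 0 ≤ starSum F (fun _ => (1 : ℝ)) i := starSum_nonneg fun _ => zero_le_one
  have hc₀0 : 0 ≤ c₀ := Finset.sum_nonneg fun i _ => hnn i
  choose M hM using fun i₀ j : ι => exists_harnack_bound (k := k) hconn hc₀0 i₀ j
  set B : ℝ := 1 + ∑ i, ∑ j, |M i j| with hB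
  have hMB : ∀ i j, M i j ≤ B := fun i j => by
    have h1 : |M i j| ≤ ∑ j, |M i j| :=
      Finset.single_le_sum (f := fun j => |M i j|) (fun _ _ => abs_nonneg _) (Finset.mem_univ j)
    have h2 : ∑ j, |M i j| ≤ ∑ i, ∑ j, |M i j| :=
      Finset.single_le_sum (f := fun i => ∑ j, |M i j|)
        (fun _ _ => Finset.sum_nonneg fun _ _ => abs_nonneg _) (Finset.mem_univ i)
    linarith [le_abs_self (M i j)]
  have hB1 : 1 ≤ B := le_add_of_nonneg_right
    (Finset.sum_nonneg fun _ _ => Finset.sum_nonneg fun _ _ => abs_nonneg _)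
  set K : Set (ℝ × (ι → ℝ)) := (Set.Icc 0 c₀ ×ˢ Set.Icc (fun _ => 1) (fun _ => B)) ∩
    {z | ∀ i, starSum F z.2 i ≤ z.1 * z.2 i ^ k} with hK
  have hKc : IsCompact K := by
    refine (isCompact_Icc.prod isCompact_Icc).inter_right ?_
    simp only [Set.ofPred_forall]
    refine isClosed_iInter fun i => isClosed_le ?_ (by fun_prop)
    unfold starSum
    fun_prop
  have hKn : K.Nonempty := by
    refine ⟨(c₀, fun _ => 1), ⟨⟨⟨hc₀0, le_rfl⟩, ⟨le_rfl, fun _ => hB1⟩⟩, fun i => ?_⟩⟩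
    simp only [one_pow, mul_one]
    exact Finset.single_le_sum (fun i _ => hnn i) (Finset.mem_univ i)
  obtain ⟨⟨c, y⟩, hcy, hmin⟩ := hKc.exists_isMinOn hKn continuous_fst.continuousOn
  refine ⟨c, ⟨y, fun i => zero_lt_one.trans_le (hcy.1.2.1 i), hcy.2⟩, ?_⟩
  intro c' hc' z hz hzc
  by_cases hcc : c' ≤ c₀
  · obtain ⟨i₀, hi₀⟩ := Finite.exists_min z
    have hz' : ∀ i, starSum F (fun j => (z i₀)⁻¹ * z j) i ≤ c' * ((z i₀)⁻¹ * z i) ^ k := by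
      intro i
      rw [starSum_smul hF, mul_pow, mul_left_comm]
      exact mul_le_mul_of_nonneg_left (hzc i) (pow_nonneg (inv_nonneg.2 (hz i₀).le) _)
    have h1 : ∀ i, 1 ≤ (z i₀)⁻¹ * z i := fun i => by
      rw [inv_mul_eq_div, one_le_div (hz i₀)]
      exact hi₀ i
    have hz'' : ∀ i, starSum F (fun j => (z i₀)⁻¹ * z j) i ≤ c₀ * ((z i₀)⁻¹ * z i) ^ k :=
      fun i => (hz' i).trans (mul_le_mul_of_nonneg_right hcc
        (pow_nonneg (zero_le_one.trans (h1 i)) _))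
    refine hmin (a := (c', fun j => (z i₀)⁻¹ * z j)) ⟨⟨⟨hc', hcc⟩, ⟨h1, fun j => ?_⟩⟩, hz'⟩
    exact (hM i₀ j _ h1 hz'' (inv_mul_cancel₀ (hz i₀).ne')).trans (hMB i₀ j)
  · exact hcy.1.1.2.trans (le_of_not_ge hcc)

/-- **Perron–Frobenius**, existence part: a connected uniform family has a positive eigenvector.
Take the least `c` for which `starSum F y ≤ c * y ^ k` has a positive solution `y`, and a solution
whose set of strict inequalities is maximal. Lowering the entry at a strict vertex makes all
neighbouring inequalities strict, so this set is empty or everything, and in the latter case `c`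
could be lowered. -/
theorem exists_pos_eigenvector [Fintype ι] [Nonempty ι] (hF : ∀ e ∈ F, e.card = k)
    (hconn : IsConnectedFamily F) :
    ∃ (c : ℝ) (y : ι → ℝ), (∀ i, 0 < y i) ∧ ∀ i, starSum F y i = c * y i ^ k := by
  obtain ⟨c, ⟨y₀, hy₀, hy₀c⟩, hmin⟩ := exists_minimal_superharmonic hF hconn
  obtain ⟨T, hT⟩ := (Set.toFinite {T : Set ι | ∃ y : ι → ℝ, (∀ i, 0 < y i) ∧
    (∀ i, starSum F y i ≤ c * y i ^ k) ∧ T = {i | starSum F y i < c * y i ^ k}}).exists_maximal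
      ⟨_, y₀, hy₀, hy₀c, rfl⟩
  obtain ⟨⟨y, hy, hyc, hTy⟩, hTmax⟩ := hT
  refine ⟨c, y, hy, fun i => (hyc i).antisymm (not_lt.1 fun hi => ?_)⟩
  have hall : ∀ i, i ∈ T := by
    refine hconn T ⟨i, hTy ▸ hi⟩ fun e he i hi hiT j hj => by_contra fun hjT => ?_
    have hij : j ≠ i := fun h => hjT (h ▸ hiT)
    have hi' : starSum F y i < c * y i ^ k := by rw [hTy] at hiT; exact hiT
    have hev : ∀ᶠ t in nhds (y i), starSum F y i < c * t ^ k ∧ 0 < t :=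
      ((continuous_const.mul (continuous_pow k)).continuousAt.eventually
        (lt_mem_nhds hi')).and (lt_mem_nhds (hy i))
    obtain ⟨t, ⟨ht1, ht0⟩, hty⟩ :=
      ((hev.filter_mono nhdsWithin_le_nhds).and (self_mem_nhdsWithin (s := Set.Iio (y i)))).exists
    have hle : ∀ l, Function.update y i t l ≤ y l := fun l => by
      by_cases h : l = i
      · subst h; simpa using (le_of_lt hty)
      · simp [h]
    have hpos : ∀ l, 0 < Function.update y i t l := fun l => by
      by_cases h : l = i
      · subst h; simpa using ht0
      · simpa [h] using hy l
    have hmono := fun l => starSum_mono (F := F) (fun l => (hpos l).le) hle l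
    have hi'' : starSum F (Function.update y i t) i < c * Function.update y i t i ^ k := by
      rw [Function.update_self]
      exact (hmono i).trans_lt ht1
    have h1 := hTmax (y := {l | starSum F (Function.update y i t) l <
        c * Function.update y i t l ^ k}) ⟨_, hpos, fun l => ?_, rfl⟩ fun l hl => ?_
    · refine hjT (h1 ?_)
      rw [Set.mem_ofPred_eq, Function.update_of_ne hij]
      exact (starSum_lt_starSum (fun l => (hpos l).le) hy hle he hj hi
        (by simpa using hty)).trans_le (hyc j)
    · by_cases h : l = i
      · subst h; exact hi''.le
      · rw [Function.update_of_ne h]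
        exact (hmono l).trans (hyc l)
    · by_cases h : l = i
      · subst h; exact hi''
      · rw [Set.mem_ofPred_eq, Function.update_of_ne h]
        rw [hTy] at hl
        exact (hmono l).trans_lt hl
  obtain ⟨j, hj⟩ := Finite.exists_max fun i => starSum F y i / y i ^ k
  have hjT := hall j
  rw [hTy] at hjT
  refine absurd ((div_lt_iff₀ (pow_pos (hy j) k)).2 hjT) (not_lt.2 (hmin _ ?_ y hy fun i => ?_))
  · exact div_nonneg (starSum_nonneg (fun i => (hy i).le) j) (pow_nonneg (hy j).le k)
  · exact (div_le_iff₀ (pow_pos (hy i) k)).1 (hj i)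

/-- **Collatz–Wielandt** bound: if `starSum F y ≤ c * y ^ k` for a positive vector `y`, with strict
inequality somewhere, then every eigenvalue has modulus less than `c`. Where `‖x i‖ / y i` is
maximal, equality of moduli would propagate along the edges to all vertices. -/
theorem norm_lt_of_starSum_le [Finite ι] (hF : ∀ e ∈ F, e.card = k)
    (hconn : IsConnectedFamily F) {c : ℝ} {y : ι → ℝ} (hy : ∀ i, 0 < y i)
    (hyc : ∀ i, starSum F y i ≤ c * y i ^ k) {i₀ : ι} (hi₀ : starSum F y i₀ < c * y i₀ ^ k)
    {l : ℂ} {x : ι → ℂ} (hx : x ≠ 0) (hl : ∀ i, starSum F x i = l * x i ^ k) : ‖l‖ < c := by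
  by_contra! hcl
  have : Nonempty ι := ⟨i₀⟩
  obtain ⟨m, hm⟩ := Finite.exists_max fun i => ‖x i‖ / y i
  set t := ‖x m‖ / y m with ht
  have hxt : ∀ i, ‖x i‖ ≤ t * y i := fun i => (div_le_iff₀ (hy i)).1 (hm i)
  have ht0 : 0 < t := by
    obtain ⟨i, hi⟩ := Function.ne_iff.1 hx
    exact (div_pos (norm_pos_iff.2 hi) (hy i)).trans_le (hm i)
  have hnorm : ∀ i, ‖x i‖ = t * y i → c * (t * y i) ^ k ≤ starSum F (fun j => ‖x j‖) i := by
    intro i hi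
    calc c * (t * y i) ^ k ≤ ‖l‖ * (t * y i) ^ k :=
          mul_le_mul_of_nonneg_right hcl (pow_nonneg (mul_pos ht0 (hy i)).le k)
      _ = ‖starSum F x i‖ := by rw [hl, norm_mul, norm_pow, hi]
      _ ≤ starSum F (fun j => ‖x j‖) i := by
          refine (norm_sum_le _ _).trans (le_of_eq ?_)
          simp only [starSum, norm_prod]
  have hty : ∀ i, starSum F (fun j => t * y j) i ≤ c * (t * y i) ^ k := by
    intro i
    rw [starSum_smul hF, mul_pow, mul_left_comm]
    exact mul_le_mul_of_nonneg_left (hyc i) (pow_nonneg ht0.le k)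
  have hall : ∀ i, ‖x i‖ = t * y i := by
    refine hconn {i | ‖x i‖ = t * y i} ⟨m, (div_mul_cancel₀ _ (hy m).ne').symm⟩ ?_
    intro e he i hi hiS j hj
    refine (hxt j).antisymm (not_lt.1 fun hlt => ?_)
    exact absurd (starSum_lt_starSum (fun i => norm_nonneg (x i)) (fun i => mul_pos ht0 (hy i))
      hxt he hi hj hlt) (not_lt.2 ((hty i).trans (hnorm i hiS)))
  have h1 := hnorm i₀ (hall i₀)
  rw [funext hall, starSum_smul hF, mul_pow, mul_left_comm] at h1
  exact absurd hi₀ (not_lt.2 (le_of_mul_le_mul_left h1 (pow_pos ht0 k)))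

end Family

noncomputable section

namespace Hypergraph

/-! ### Spectral theory of uniform hypergraphs -/

/-- The sum over the edges `s` of `H` containing `a` of the products `∏ b ∈ s, x b`. Here `x` is a
function on the whole ambient type, so that it can be restricted and extended freely when paths are
attached; its values outside the vertex set of `H` are irrelevant. -/
def incidentSum {α R : Type*} [CommSemiring R] (H : Hypergraph α) (x : α → R) (a : α) : R :=
  ∑ᶠ s ∈ {s | s ∈ E(H) ∧ a ∈ s}, ∏ᶠ b ∈ s, x b

/-- Any set that meets the vertex set of `H` and contains every edge it meets contains the vertex
set. This is the consequence of connectedness that the spectral theory uses, and it is easily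
transferred when paths are attached. -/
def IsEdgeConnected {α : Type*} (H : Hypergraph α) : Prop :=
  ∀ S : Set α, (∃ a ∈ V(H), a ∈ S) → (∀ e ∈ E(H), ∀ a ∈ e, a ∈ S → e ⊆ S) → V(H) ⊆ S

lemma IsConnected.isEdgeConnected {α : Type*} {H : Hypergraph α} (h : H.IsConnected) :
    H.IsEdgeConnected := by
  rintro S ⟨a, ha, haS⟩ hS b hb
  obtain ⟨n, w, f, hwf, rfl, rfl⟩ := h.2 a ha b hb
  have : ∀ i, w i ∈ S := by
    intro i
    induction i using Fin.induction with
    | zero => exact haS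
    | succ i ih => exact hS _ (hwf.2.1 i) _ (hwf.2.2.2.2 i).1 ih (hwf.2.2.2.2 i).2
  exact this _

section Finite

variable {α : Type*} [Finite α]

/-- The edges of `H` as a family of finite sets of vertices. -/
def edgeFamily (H : Hypergraph α) : Finset (Finset V(H)) :=
  (Set.toFinite {s : Finset V(H) | Subtype.val '' (s : Set V(H)) ∈ E(H)}).toFinset

lemma mem_edgeFamily {H : Hypergraph α} {s : Finset V(H)} :
    s ∈ H.edgeFamily ↔ Subtype.val '' (s : Set V(H)) ∈ E(H) := by
  simp [edgeFamily]

lemma exists_mem_edgeFamily {H : Hypergraph α} {e : Set α} (he : e ∈ E(H)) :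
    ∃ s ∈ H.edgeFamily, Subtype.val '' (s : Set V(H)) = e := by
  have h1 : Subtype.val '' (((Set.toFinite (Subtype.val ⁻¹' e : Set V(H))).toFinset :
      Finset V(H)) : Set V(H)) = e := by
    rw [Set.Finite.coe_toFinset, Subtype.image_preimage_coe]
    exact Set.inter_eq_right.2 (H.subset_vertexSet_of_mem_edgeSet' he)
  exact ⟨_, mem_edgeFamily.2 (h1.symm ▸ he), h1⟩

lemma IsUniform.card_of_mem_edgeFamily {H : Hypergraph α} {k : ℕ} (hH : H.IsUniform k)
    {s : Finset V(H)} (hs : s ∈ H.edgeFamily) : s.card = k := by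
  have h := hH _ (mem_edgeFamily.1 hs)
  rw [Subtype.val_injective.encard_image, Set.encard_coe_eq_coe_finsetCard] at h
  exact_mod_cast h

lemma IsEdgeConnected.isConnectedFamily {H : Hypergraph α} (hH : H.IsEdgeConnected) :
    IsConnectedFamily H.edgeFamily := by
  rintro S ⟨a, ha⟩ hS b
  have h1 := hH (Subtype.val '' S) ⟨a, a.2, a, ha, rfl⟩ ?_ b.2
  · obtain ⟨b', hb', h⟩ := h1
    rwa [← Subtype.ext h]
  · rintro e he _ hae ⟨a, ha, rfl⟩
    obtain ⟨s, hs, rfl⟩ := exists_mem_edgeFamily he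
    obtain ⟨a', ha', h⟩ := hae
    obtain rfl := Subtype.ext h
    rintro _ ⟨b, hb, rfl⟩
    exact ⟨b, hS s hs _ ha' ha b hb, rfl⟩

lemma starSum_edgeFamily {R : Type*} [CommSemiring R] [DecidableEq α] (H : Hypergraph α)
    (x : α → R) (a : V(H)) : starSum H.edgeFamily (fun b => x b) a = H.incidentSum x a := by
  have h1 : {s | s ∈ E(H) ∧ (a : α) ∈ s} = (fun s : Finset V(H) => Subtype.val '' (s : Set V(H))) ''
      ((H.edgeFamily.filter fun s => a ∈ s : Finset (Finset V(H))) : Set (Finset V(H))) := by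
    ext e
    constructor
    · rintro ⟨he, ha⟩
      obtain ⟨s, hs, rfl⟩ := exists_mem_edgeFamily he
      obtain ⟨a', ha', h⟩ := ha
      obtain rfl := Subtype.ext h
      exact ⟨s, by simp [hs]; exact ha', rfl⟩
    · rintro ⟨s, hs, rfl⟩
      obtain ⟨hs, ha⟩ := Finset.mem_filter.1 (Finset.mem_coe.1 hs)
      exact ⟨mem_edgeFamily.1 hs, a, ha, rfl⟩
  rw [incidentSum, h1, finsum_mem_image, finsum_mem_coe_finset, starSum]
  · refine Finset.sum_congr rfl fun s _ => ?_
    rw [finprod_mem_image Subtype.val_injective.injOn, finprod_mem_coe_finset]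
  · intro s _ t _ h
    exact Finset.coe_injective (Subtype.val_injective.image_injective h)

end Finite

section Fintype

variable {α : Type*} [Fintype α] {H : Hypergraph α} {k : ℕ}

lemma tensorApply_adjTensor_mul [Fintype V(H)] (hk : 1 ≤ k) (hH : H.IsUniform k) (x : α → ℂ)
    (a : V(H)) : tensorApply (H.adjTensor k) (fun b => x b) a * x a = H.incidentSum x a := by
  classical
  rw [← starSum_edgeFamily]
  refine tensorApply_mul_eq_starSum (fun s hs => ?_) (fun f => ?_) _ a
  · rw [hH.card_of_mem_edgeFamily hs]
    omega
  · have h1 : Set.range (fun j => (f j : α)) =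
        Subtype.val '' ((Finset.univ.image f : Finset V(H)) : Set V(H)) := by
      rw [Finset.coe_image, Finset.coe_univ, Set.image_univ, ← Set.range_comp]
      rfl
    rw [adjTensor, h1]
    simp only [mem_edgeFamily]

lemma incidentSum_ofReal (x : α → ℝ) (a : α) :
    H.incidentSum (fun b => (x b : ℂ)) a = ((H.incidentSum x a : ℝ) : ℂ) := by
  classical
  simp only [incidentSum, finprod_mem_eq_toFinset_prod, finsum_mem_eq_toFinset_sum]
  push_cast
  rfl

lemma exists_pos_eigenvector_le_spectralRadius (hk : 3 ≤ k) (hH : H.IsUniform k)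
    (hconn : H.IsEdgeConnected) (hne : V(H).Nonempty) :
    ∃ (c : ℝ) (x : α → ℝ), (∀ a, 0 < x a) ∧ (∀ a ∈ V(H), H.incidentSum x a = c * x a ^ k) ∧
      c ≤ H.spectralRadius k := by
  classical
  have : Nonempty V(H) := hne.to_subtype
  obtain ⟨c, y, hy, hyc⟩ := exists_pos_eigenvector (F := H.edgeFamily)
    (fun s hs => hH.card_of_mem_edgeFamily hs) hconn.isConnectedFamily
  set x : α → ℝ := fun a => if h : a ∈ V(H) then y ⟨a, h⟩ else 1 with hx
  have hxy : (fun b : V(H) => x b) = y := by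
    funext b
    simp [hx]
  have hxpos : ∀ a, 0 < x a := fun a => by
    by_cases h : a ∈ V(H)
    · simp [hx, h, hy]
    · simp [hx, h]
  have hxc : ∀ a ∈ V(H), H.incidentSum x a = c * x a ^ k := by
    intro a ha
    have h1 := hyc ⟨a, ha⟩
    rw [← hxy, starSum_edgeFamily H x ⟨a, ha⟩] at h1
    exact h1
  refine ⟨c, x, hxpos, hxc, (le_abs_self c).trans ?_⟩
  refine (isGreatest_spectralRadius H k hk hH hne).2 ⟨(c : ℂ), ⟨fun b => (x b : ℂ), ?_, ?_⟩, by simp⟩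
  · obtain ⟨a, ha⟩ := hne
    exact Function.ne_iff.2 ⟨⟨a, ha⟩, by simpa using (hxpos a).ne'⟩
  · intro a
    have hxa : (x a : ℂ) ≠ 0 := by exact_mod_cast (hxpos a).ne'
    refine mul_right_cancel₀ hxa ?_
    rw [tensorApply_adjTensor_mul (by omega) hH (fun b => (x b : ℂ)), incidentSum_ofReal,
      hxc a a.2, mul_assoc, ← pow_succ, Nat.sub_add_cancel (by omega)]
    push_cast
    rfl

lemma spectralRadius_lt_of_incidentSum_le (hk : 3 ≤ k) (hH : H.IsUniform k)
    (hconn : H.IsEdgeConnected) {c : ℝ} {y : α → ℝ} (hy : ∀ a, 0 < y a)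
    (hyc : ∀ a ∈ V(H), H.incidentSum y a ≤ c * y a ^ k) {w : α} (hw : w ∈ V(H))
    (hwc : H.incidentSum y w < c * y w ^ k) : H.spectralRadius k < c := by
  classical
  obtain ⟨l, ⟨x, hx, hl⟩, hlr⟩ := (isGreatest_spectralRadius H k hk hH ⟨w, hw⟩).1
  rw [← hlr]
  set X : α → ℂ := fun a => if h : a ∈ V(H) then x ⟨a, h⟩ else 0 with hX
  have hXx : (fun b : V(H) => X b) = x := by
    funext b
    simp [hX]
  refine norm_lt_of_starSum_le (F := H.edgeFamily) (y := fun b => y b)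
    (fun s hs => hH.card_of_mem_edgeFamily hs)
    hconn.isConnectedFamily (fun b => hy b) (fun b => ?_) (i₀ := ⟨w, hw⟩) ?_ hx fun b => ?_
  · rw [starSum_edgeFamily H y]
    exact hyc b b.2
  · rw [starSum_edgeFamily H y]
    exact hwc
  · have h1 := tensorApply_adjTensor_mul (by omega) hH X b
    rw [hXx, hl b, mul_assoc] at h1
    rw [← hXx, starSum_edgeFamily H X, ← h1]
    have h2 : X b = x b := congrFun hXx b
    rw [← h2, ← pow_succ, Nat.sub_add_cancel (by omega)]

end Fintype

end Hypergraph

end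

noncomputable section

namespace Hypergraph

/-! ### Attached paths: edges and connectivity -/

/-- The vertex that the `i`-th edge of a path attached at `u` shares with what precedes it: `u` for
`i = 0`, and the vertex `(i - 1, 0)` of the preceding edge for `1 ≤ i ≤ p`. Beyond the end of the
path the value is arbitrary. -/
def pathVertex {α : Type*} {k : ℕ} (hk : 3 ≤ k) (u : α) (p : ℕ) : ℕ → α ⊕ Fin p × Fin (k - 1)
  | 0 => Sum.inl u
  | i + 1 => if h : i < p then Sum.inr (⟨i, h⟩, ⟨0, by omega⟩) else Sum.inl u

/-- The product of the entries of `x` over the `i`-th edge of a path of length `p` attached at `u`,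
and `0` if there is no such edge, that is, for `i ≥ p`. -/
def pathEdgeProd {α : Type*} {k : ℕ} (hk : 3 ≤ k) (u : α) (p : ℕ)
    (x : α ⊕ Fin p × Fin (k - 1) → ℝ) (i : ℕ) : ℝ :=
  if h : i < p then x (pathVertex hk u p i) * ∏ j, x (Sum.inr (⟨i, h⟩, j)) else 0

section

variable {α : Type*} {k : ℕ} (hk : 3 ≤ k) {u : α} {p : ℕ}

lemma attachedEdge_eq_insert (i : Fin p) : attachedEdge k u p i =
    insert (pathVertex hk u p i) (Set.range fun j => Sum.inr (i, j)) := by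
  obtain ⟨i, hi⟩ := i
  ext z
  simp only [attachedEdge, Set.mem_ofPred_eq, Set.mem_insert_iff, Set.mem_range]
  cases i with
  | zero =>
    simp only [pathVertex]
    constructor
    · rintro (⟨j, rfl⟩ | ⟨-, rfl⟩ | ⟨i', j, h, -⟩)
      · exact Or.inr ⟨j, rfl⟩
      · exact Or.inl rfl
      · simp at h
    · rintro (rfl | ⟨j, rfl⟩)
      · exact Or.inr (Or.inl ⟨trivial, rfl⟩)
      · exact Or.inl ⟨j, rfl⟩
  | succ i =>
    have hi' : i < p := by omega
    simp only [pathVertex, hi', dif_pos]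
    constructor
    · rintro (⟨j, rfl⟩ | ⟨h, -⟩ | ⟨i', j, h, h', rfl⟩)
      · exact Or.inr ⟨j, rfl⟩
      · simp at h
      · refine Or.inl ?_
        have h1 : i' = ⟨i, hi'⟩ := Fin.ext (by simpa using h)
        have h2 : j = ⟨0, by omega⟩ := Fin.ext h'
        rw [h1, h2]
    · rintro (rfl | ⟨j, rfl⟩)
      · exact Or.inr (Or.inr ⟨_, _, rfl, rfl, rfl⟩)
      · exact Or.inl ⟨j, rfl⟩

lemma pathVertex_notMem_range (i : Fin p) :
    pathVertex hk u p i ∉ Set.range fun j : Fin (k - 1) => (Sum.inr (i, j) : α ⊕ _) := by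
  obtain ⟨i, hi⟩ := i
  rintro ⟨j, hj⟩
  cases i with
  | zero => simp [pathVertex] at hj
  | succ i =>
    have hi' : i < p := by omega
    simp [pathVertex, hi'] at hj

lemma inl_mem_attachedEdge {a : α} {i : Fin p} :
    Sum.inl a ∈ attachedEdge k u p i ↔ (i : ℕ) = 0 ∧ a = u := by
  simp [attachedEdge]

lemma inr_mem_attachedEdge {i i' : Fin p} {j : Fin (k - 1)} :
    Sum.inr (i, j) ∈ attachedEdge k u p i' ↔
      (i' : ℕ) = i ∨ ((j : ℕ) = 0 ∧ (i' : ℕ) = i + 1) := by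
  simp only [attachedEdge, Set.mem_ofPred_eq, Sum.inr.injEq, Prod.mk.injEq, reduceCtorEq, and_false,
    false_or]
  constructor
  · rintro (⟨_, rfl, rfl⟩ | ⟨_, _, h, h', rfl, rfl⟩)
    · exact Or.inl rfl
    · exact Or.inr ⟨h', h.symm⟩
  · rintro (h | ⟨h, h'⟩)
    · exact Or.inl ⟨j, (Fin.ext h).symm, rfl⟩
    · exact Or.inr ⟨i, j, h'.symm, h, rfl, rfl⟩

lemma attachedEdge_injective (hk : 3 ≤ k) : Function.Injective (attachedEdge k u p) := by
  intro i i' h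
  -- A vertex other than `(i, 0)` of the `i`-th block lies on no other edge of the path.
  have h1 : (Sum.inr (i, ⟨1, by omega⟩) : α ⊕ Fin p × Fin (k - 1)) ∈ attachedEdge k u p i' :=
    h ▸ inr_mem_attachedEdge.2 (Or.inl rfl)
  rcases inr_mem_attachedEdge.1 h1 with h2 | ⟨h2, -⟩
  · exact (Fin.ext h2).symm
  · simp at h2

lemma IsUniform.attachPath {H : Hypergraph α} (hk : 3 ≤ k) (hH : H.IsUniform k) :
    (H.attachPath k u p).IsUniform k := by
  rintro _ (⟨e, he, rfl⟩ | ⟨i, rfl⟩)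
  · rw [Sum.inl_injective.encard_image, hH e he]
  · have hinj : Function.Injective fun j : Fin (k - 1) => (Sum.inr (i, j) : α ⊕ _) :=
      fun j j' h => by simpa using h
    rw [attachedEdge_eq_insert hk, Set.encard_insert_of_notMem (pathVertex_notMem_range hk i),
      ← Set.image_univ, hinj.encard_image, Set.encard_univ]
    simp only [ENat.card_eq_coe_fintype_card, Fintype.card_fin]
    have : k - 1 + 1 = k := by omega
    exact_mod_cast this

lemma IsEdgeConnected.attachPath {H : Hypergraph α} (hk : 3 ≤ k) (hH : H.IsEdgeConnected)
    (hu : u ∈ V(H)) : (H.attachPath k u p).IsEdgeConnected := by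
  intro S hSne hS
  have hedge : ∀ i : Fin p, ∀ a ∈ attachedEdge k u p i, a ∈ S → attachedEdge k u p i ⊆ S :=
    fun i => hS _ (Or.inr ⟨i, rfl⟩)
  -- From any new vertex of `S` one descends along the path to `u`.
  have hdown : ∀ n (hn : n < p) j, Sum.inr (⟨n, hn⟩, j) ∈ S → Sum.inl u ∈ S := by
    intro n
    induction n with
    | zero =>
      intro hn j h
      exact hedge ⟨0, hn⟩ _ (inr_mem_attachedEdge.2 (Or.inl rfl)) h
        (inl_mem_attachedEdge.2 ⟨rfl, rfl⟩)
    | succ n ih =>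
      intro hn j h
      refine ih (by omega) ⟨0, by omega⟩ (hedge ⟨n + 1, hn⟩ _
        (inr_mem_attachedEdge.2 (Or.inl rfl)) h (inr_mem_attachedEdge.2 (Or.inr ⟨rfl, rfl⟩)))
  have huS : ∃ a ∈ V(H), Sum.inl a ∈ S := by
    obtain ⟨z, hz, hzS⟩ := hSne
    rcases hz with ⟨a, ha, rfl⟩ | ⟨⟨i, j⟩, rfl⟩
    · rw [Set.insert_eq_of_mem hu] at ha
      exact ⟨a, ha, hzS⟩
    · exact ⟨u, hu, hdown i i.2 j hzS⟩
  have hV : V(H) ⊆ Sum.inl ⁻¹' S := by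
    refine hH _ huS fun e he a ha haS b hb => ?_
    exact hS _ (Or.inl ⟨e, he, rfl⟩) _ (Set.mem_image_of_mem _ ha) haS (Set.mem_image_of_mem _ hb)
  have hup : ∀ n (hn : n < p) j, Sum.inr (⟨n, hn⟩, j) ∈ S := by
    intro n
    induction n with
    | zero =>
      intro hn j
      exact hedge ⟨0, hn⟩ _ (inl_mem_attachedEdge.2 ⟨rfl, rfl⟩) (hV hu)
        (inr_mem_attachedEdge.2 (Or.inl rfl))
    | succ n ih =>
      intro hn j
      exact hedge ⟨n + 1, hn⟩ _ (inr_mem_attachedEdge.2 (Or.inr ⟨rfl, rfl⟩))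
        (ih (by omega) ⟨0, by omega⟩) (inr_mem_attachedEdge.2 (Or.inl rfl))
  rintro _ (⟨a, ha, rfl⟩ | ⟨⟨i, j⟩, rfl⟩)
  · rw [Set.insert_eq_of_mem hu] at ha
    exact hV ha
  · exact hup i i.2 j

lemma inl_mem_vertexSet_attachPath {H : Hypergraph α} {a : α} (ha : a ∈ V(H)) :
    Sum.inl a ∈ V(H.attachPath k u p) :=
  Or.inl ⟨a, Set.mem_insert_of_mem _ ha, rfl⟩

lemma inr_mem_vertexSet_attachPath {H : Hypergraph α} (b : Fin p × Fin (k - 1)) :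
    Sum.inr b ∈ V(H.attachPath k u p) :=
  Or.inr ⟨b, rfl⟩

lemma mem_vertexSet_attachPath {H : Hypergraph α} (hu : u ∈ V(H)) {z : α ⊕ Fin p × Fin (k - 1)}
    (hz : z ∈ V(H.attachPath k u p)) : (∃ a ∈ V(H), z = Sum.inl a) ∨ ∃ b, z = Sum.inr b := by
  rcases hz with ⟨a, ha, rfl⟩ | ⟨b, rfl⟩
  · rw [Set.insert_eq_of_mem hu] at ha
    exact Or.inl ⟨a, ha, rfl⟩
  · exact Or.inr ⟨b, rfl⟩

lemma finprod_attachedEdge (x : α ⊕ Fin p × Fin (k - 1) → ℝ) (i : Fin p) :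
    ∏ᶠ b ∈ attachedEdge k u p i, x b = pathEdgeProd hk u p x i := by
  rw [attachedEdge_eq_insert hk, finprod_mem_insert _ (pathVertex_notMem_range hk i)
    (Set.finite_range _), finprod_mem_range, finprod_eq_prod_of_fintype, pathEdgeProd, dif_pos i.2]
  intro j j' h
  simpa using h

lemma sum_ite_pathEdgeProd (x : α ⊕ Fin p × Fin (k - 1) → ℝ) (n : ℕ) :
    (∑ i : Fin p, if (i : ℕ) = n then pathEdgeProd hk u p x i else 0) =
      pathEdgeProd hk u p x n := by
  by_cases hn : n < p
  · rw [Finset.sum_eq_single ⟨n, hn⟩]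
    · simp
    · intro i _ hi
      exact if_neg fun h => hi (Fin.ext h)
    · simp
  · rw [pathEdgeProd, dif_neg hn]
    exact Finset.sum_eq_zero fun i _ => if_neg (by omega)

variable [Finite α] (H : Hypergraph α)

open scoped Classical in
lemma incidentSum_attachPath (x : α ⊕ Fin p × Fin (k - 1) → ℝ) (z : α ⊕ Fin p × Fin (k - 1)) :
    (H.attachPath k u p).incidentSum x z =
      (∑ᶠ s ∈ {s | s ∈ E(H) ∧ z ∈ Sum.inl '' s}, ∏ᶠ b ∈ s, x (Sum.inl b)) +
        ∑ i : Fin p, if z ∈ attachedEdge k u p i then pathEdgeProd hk u p x i else 0 := by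
  have h1 : {s | s ∈ E(H.attachPath k u p) ∧ z ∈ s} =
      (fun s => Sum.inl '' s) '' {s | s ∈ E(H) ∧ z ∈ Sum.inl '' s} ∪
        attachedEdge k u p '' {i | z ∈ attachedEdge k u p i} := by
    ext s
    constructor
    · rintro ⟨⟨e, he, rfl⟩ | ⟨i, rfl⟩, hz⟩
      · exact Or.inl ⟨e, ⟨he, hz⟩, rfl⟩
      · exact Or.inr ⟨i, hz, rfl⟩
    · rintro (⟨e, ⟨he, hz⟩, rfl⟩ | ⟨i, hz, rfl⟩)
      · exact ⟨Or.inl ⟨e, he, rfl⟩, hz⟩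
      · exact ⟨Or.inr ⟨i, rfl⟩, hz⟩
  have h2 : Disjoint ((fun s => Sum.inl '' s) '' {s | s ∈ E(H) ∧ z ∈ Sum.inl '' s})
      (attachedEdge k u p '' {i | z ∈ attachedEdge k u p i}) := by
    rw [Set.disjoint_left]
    rintro _ ⟨e, -, rfl⟩ ⟨i, -, h⟩
    have h3 : (Sum.inr (i, ⟨0, by omega⟩) : α ⊕ Fin p × Fin (k - 1)) ∈ attachedEdge k u p i :=
      inr_mem_attachedEdge.2 (Or.inl rfl)
    rw [h] at h3
    obtain ⟨a, -, h⟩ := h3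
    simp at h
  rw [incidentSum, h1, finsum_mem_union h2 (Set.toFinite _) (Set.toFinite _),
    finsum_mem_image Sum.inl_injective.image_injective.injOn,
    finsum_mem_image (attachedEdge_injective hk).injOn]
  congr 1
  · refine finsum_mem_congr rfl fun s _ => ?_
    rw [finprod_mem_image Sum.inl_injective.injOn]
  · simp only [finprod_attachedEdge hk]
    rw [finsum_mem_eq_toFinset_sum, ← Finset.sum_filter]
    congr 1
    ext i
    simp

open scoped Classical in
lemma incidentSum_attachPath_inl (x : α ⊕ Fin p × Fin (k - 1) → ℝ) (a : α) :
    (H.attachPath k u p).incidentSum x (Sum.inl a) =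
      H.incidentSum (fun b => x (Sum.inl b)) a +
        if a = u then pathEdgeProd hk u p x 0 else 0 := by
  rw [incidentSum_attachPath hk]
  congr 1
  · refine finsum_mem_congr ?_ fun _ _ => rfl
    ext s
    simp
  · simp only [inl_mem_attachedEdge]
    split_ifs with h
    · simp only [h, and_true]
      exact sum_ite_pathEdgeProd hk x 0
    · simp [h]

lemma incidentSum_attachPath_inr (x : α ⊕ Fin p × Fin (k - 1) → ℝ) (i : Fin p)
    (j : Fin (k - 1)) :
    (H.attachPath k u p).incidentSum x (Sum.inr (i, j)) =
      pathEdgeProd hk u p x i + if (j : ℕ) = 0 then pathEdgeProd hk u p x (i + 1) else 0 := by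
  classical
  rw [incidentSum_attachPath hk]
  have h1 : {s | s ∈ E(H) ∧ (Sum.inr (i, j) : α ⊕ Fin p × Fin (k - 1)) ∈ Sum.inl '' s} = ∅ := by
    ext s
    simp
  rw [h1, finsum_mem_empty, zero_add]
  simp only [inr_mem_attachedEdge]
  split_ifs with hj
  · rw [← sum_ite_pathEdgeProd hk x i, ← sum_ite_pathEdgeProd hk x (i + 1),
      ← Finset.sum_add_distrib]
    refine Finset.sum_congr rfl fun i' _ => ?_
    by_cases h : (i' : ℕ) = i <;> simp [h, hj]
  · simp only [hj, false_and, or_false, add_zero]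
    exact sum_ite_pathEdgeProd hk x i

end

end Hypergraph

end

noncomputable section

namespace Hypergraph

/-! ### Eigenvectors along an attached path -/

/-- The weights along an attached path, counted from its free end: `0`, and then
`f (n + 1) = r / (1 - f n)`. With `r = c⁻ᵏ`, the value `pathWeight r n` is the proportion of
`c * x u ^ k` that a path of length `n` attached at `u` contributes for an eigenvector `x` with
eigenvalue `c`. -/
def pathWeight (r : ℝ) : ℕ → ℝ
  | 0 => 0
  | n + 1 => r / (1 - pathWeight r n)

lemma pathWeight_succ_pos {r : ℝ} (hr : 0 < r) {n : ℕ} (h : pathWeight r n < 1) :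
    0 < pathWeight r (n + 1) :=
  div_pos hr (by linarith)

lemma pathWeight_lt_succ {r : ℝ} (hr : 0 < r) {n : ℕ} (h : ∀ m ≤ n, pathWeight r m < 1) :
    pathWeight r n < pathWeight r (n + 1) := by
  induction n with
  | zero => simpa [pathWeight] using hr
  | succ n ih =>
    have h1 := ih fun m hm => h m (by omega)
    have h2 := h (n + 1) le_rfl
    exact div_lt_div_of_pos_left hr (by linarith) (by linarith)

lemma pathWeight_lt_pathWeight {r : ℝ} (hr : 0 < r) {m n : ℕ} (hmn : m < n)
    (h : ∀ l < n, pathWeight r l < 1) : pathWeight r m < pathWeight r n := by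
  induction n, hmn using Nat.le_induction with
  | base => exact pathWeight_lt_succ hr fun l hl => h l (by omega)
  | succ n hn ih =>
    exact (ih fun l hl => h l (by omega)).trans (pathWeight_lt_succ hr fun l hl => h l (by omega))

lemma exists_pos_pow_eq {k : ℕ} (hk : k ≠ 0) {t : ℝ} (ht : 0 < t) : ∃ s : ℝ, 0 < s ∧ s ^ k = t :=
  ⟨t ^ (k⁻¹ : ℝ), Real.rpow_pos_of_pos ht _, Real.rpow_inv_natCast_pow ht.le hk⟩

/-- The `k`-th power of the product over an edge with vertex entries `t` and `z j`, when the numbers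
`z j ^ k` all equal `N` once the one for `j = 0` is weighted by `d`. -/
lemma edge_pow_mul_eq {k : ℕ} (hk : 3 ≤ k) {t d N : ℝ} {z : Fin (k - 1) → ℝ}
    (h : ∀ j, z j ^ k * (if (j : ℕ) = 0 then d else 1) = N) :
    (t * ∏ j, z j) ^ k * d = t ^ k * N ^ (k - 1) := by
  have h1 : ∏ j : Fin (k - 1), (if (j : ℕ) = 0 then d else 1) = d := by
    rw [Finset.prod_eq_single ⟨0, by omega⟩]
    · simp
    · intro j _ hj
      exact if_neg fun h => hj (Fin.ext h)
    · simp
  have h2 : ∏ j : Fin (k - 1), (z j ^ k * (if (j : ℕ) = 0 then d else 1)) = N ^ (k - 1) := by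
    simp [h]
  rw [Finset.prod_mul_distrib, h1, Finset.prod_pow] at h2
  rw [mul_pow, mul_assoc, h2]

section

variable {α : Type*} {k : ℕ} (hk : 3 ≤ k) {u : α} {p : ℕ} [Finite α] (H : Hypergraph α)

/-- An eigenvector with eigenvalue `c` on the new vertices of an attached path determines the
weights along the path: from the free end towards `u`, each edge contributes the proportion
`pathWeight` at the vertex where it is attached. -/
lemma pathEdgeProd_eq_of_eigenvector {c : ℝ} (hc : 0 < c) {x : α ⊕ Fin p × Fin (k - 1) → ℝ}
    (hx : ∀ b, 0 < x b)
    (hxc : ∀ b, (H.attachPath k u p).incidentSum x (Sum.inr b) = c * x (Sum.inr b) ^ k) :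
    (∀ n < p, pathWeight (c ^ k)⁻¹ n < 1) ∧
      pathEdgeProd hk u p x 0 = c * pathWeight (c ^ k)⁻¹ p * x (Sum.inl u) ^ k := by
  suffices h : ∀ n ≤ p, (∀ m < n, pathWeight (c ^ k)⁻¹ m < 1) ∧ pathEdgeProd hk u p x (p - n) =
      c * pathWeight (c ^ k)⁻¹ n * x (pathVertex hk u p (p - n)) ^ k by
    have := h p le_rfl
    rwa [Nat.sub_self] at this
  intro n
  induction n with
  | zero => simp [pathWeight, pathEdgeProd]
  | succ n ih =>
    intro hn
    obtain ⟨ih1, ih2⟩ := ih (by omega)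
    obtain ⟨i, hi⟩ : ∃ i, i = p - (n + 1) := ⟨_, rfl⟩
    have hip : i < p := by omega
    rw [show p - n = i + 1 by omega] at ih2
    rw [← hi]
    set f := pathWeight (c ^ k)⁻¹ n with hf
    set E := pathEdgeProd hk u p x i with hE
    have hEeq : E = x (pathVertex hk u p i) * ∏ j, x (Sum.inr (⟨i, hip⟩, j)) := by
      rw [hE, pathEdgeProd, dif_pos hip]
    have hEpos : 0 < E := by
      rw [hEeq]
      exact mul_pos (hx _) (Finset.prod_pos fun j _ => hx _)
    have hz : ∀ j, c * (x (Sum.inr (⟨i, hip⟩, j)) ^ k * if (j : ℕ) = 0 then 1 - f else 1) = E := by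
      intro j
      have h1 := hxc (⟨i, hip⟩, j)
      rw [incidentSum_attachPath_inr hk] at h1
      split_ifs at h1 ⊢ with hj
      · have h2 : pathVertex hk u p (i + 1) = Sum.inr (⟨i, hip⟩, j) := by
          have h3 : j = ⟨0, by omega⟩ := Fin.ext hj
          rw [h3, pathVertex, dif_pos hip]
        rw [ih2, h2] at h1
        linear_combination -h1
      · linear_combination -h1
    have hf1 : f < 1 := by
      have h1 := hz ⟨0, by omega⟩
      rw [if_pos rfl] at h1
      have h2 : 0 < c * x (Sum.inr (⟨i, hip⟩, ⟨0, by omega⟩)) ^ k := mul_pos hc (pow_pos (hx _) k)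
      by_contra! h
      nlinarith
    refine ⟨fun m hm => ?_, ?_⟩
    · rcases Nat.lt_succ_iff_lt_or_eq.1 hm with h | rfl
      · exact ih1 m h
      · exact hf1
    · have h1 := edge_pow_mul_eq hk (t := x (pathVertex hk u p i)) (d := 1 - f) (N := E / c)
        (z := fun j => x (Sum.inr (⟨i, hip⟩, j))) fun j => by
          rw [← hz j, mul_div_cancel_left₀ _ hc.ne']
      rw [← hEeq] at h1
      obtain ⟨m, rfl⟩ : ∃ m, k = m + 1 := ⟨k - 1, by omega⟩
      rw [Nat.add_sub_cancel, div_pow] at h1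
      have hd : 1 - f ≠ 0 := by linarith
      have h2 : E * (1 - f) = x (pathVertex hk u p i) ^ (m + 1) / c ^ m := by
        refine mul_left_cancel₀ (pow_pos hEpos m).ne' ?_
        rw [pow_succ] at h1
        linear_combination h1
      rw [pathWeight, ← hf]
      have hcm := pow_pos hc m
      field_simp at h2 ⊢
      linear_combination c * h2

/-- Conversely, as long as the weights stay below one, every positive vector extends to the new
vertices of an attached path so that the eigenvalue equation holds there. -/
lemma exists_extension_attachPath (u : α) {c : ℝ} (hc : 0 < c)
    (hp : ∀ n < p, pathWeight (c ^ k)⁻¹ n < 1)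
    {y : α → ℝ} (hy : ∀ a, 0 < y a) :
    ∃ x : α ⊕ Fin p × Fin (k - 1) → ℝ, (∀ b, 0 < x b) ∧ (∀ a, x (Sum.inl a) = y a) ∧
      (∀ b, (H.attachPath k u p).incidentSum x (Sum.inr b) = c * x (Sum.inr b) ^ k) ∧
      pathEdgeProd hk u p x 0 = c * pathWeight (c ^ k)⁻¹ p * y u ^ k := by
  have hr : 0 < (c ^ k)⁻¹ := inv_pos.2 (pow_pos hc k)
  set f := pathWeight (c ^ k)⁻¹ with hf
  -- At the vertex where edge `i` is attached, `p - i` edges of the path lie ahead.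
  have hfpos : ∀ i < p, 0 < f (p - i) := fun i hi => by
    rw [show p - i = (p - i - 1) + 1 by omega]
    exact pathWeight_succ_pos hr (hp _ (by omega))
  have hroot : ∀ (i : Fin p) (j : Fin (k - 1)), ∃ s : ℝ, 0 < s ∧
      s ^ k = f (p - i) / if (j : ℕ) = 0 then 1 - f (p - i - 1) else 1 := fun i j => by
    refine exists_pos_pow_eq (by omega) (div_pos (hfpos i i.2) ?_)
    split_ifs
    · linarith [hp (p - i - 1) (by omega)]
    · exact one_pos
  choose s hs0 hs using hroot
  set t : ℕ → ℝ := fun n => Nat.rec (y u)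
    (fun i ti => if h : i < p then ti * s ⟨i, h⟩ ⟨0, by omega⟩ else ti) n with ht
  have ht0 : t 0 = y u := rfl
  have hts : ∀ i (h : i < p), t (i + 1) = t i * s ⟨i, h⟩ ⟨0, by omega⟩ := fun i h => by
    simp only [ht]
    rw [dif_pos h]
  have htpos : ∀ i ≤ p, 0 < t i := by
    intro i
    induction i with
    | zero => exact fun _ => hy u
    | succ i ih =>
      intro hi
      rw [hts i hi]
      exact mul_pos (ih (by omega)) (hs0 _ _)
  set x : α ⊕ Fin p × Fin (k - 1) → ℝ := Sum.elim y fun b => t b.1 * s b.1 b.2 with hx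
  have hxv : ∀ i ≤ p, x (pathVertex hk u p i) = t i := by
    intro i hi
    cases i with
    | zero => rfl
    | succ i =>
      rw [pathVertex, dif_pos (show i < p from hi), hts i hi]
      rfl
  have hE : ∀ i ≤ p, pathEdgeProd hk u p x i = c * f (p - i) * t i ^ k := by
    intro i hi
    rcases hi.lt_or_eq with hi | rfl
    · have hd : 0 < 1 - f (p - i - 1) := by linarith [hp (p - i - 1) (by omega)]
      have hfs : f (p - i) = (c ^ k)⁻¹ / (1 - f (p - i - 1)) := by
        conv_lhs => rw [show p - i = (p - i - 1) + 1 by omega]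
        rfl
      have h1 := edge_pow_mul_eq hk (t := t i) (d := 1 - f (p - i - 1)) (N := t i ^ k * f (p - i))
        (z := fun j => t i * s ⟨i, hi⟩ j) fun j => by
          rw [mul_pow, hs]
          split_ifs
          · field_simp
          · ring
      rw [pathEdgeProd, dif_pos hi, hxv i hi.le]
      refine (pow_left_inj₀ ?_ ?_ (show k ≠ 0 by omega)).1 ?_
      · exact mul_nonneg (htpos i hi.le).le
          (Finset.prod_nonneg fun j _ => (mul_pos (htpos i hi.le) (hs0 _ _)).le)
      · exact mul_nonneg (mul_pos hc (hfpos i hi)).le (pow_pos (htpos i hi.le) k).le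
      · refine mul_right_cancel₀ hd.ne' (h1.trans ?_)
        have hck := pow_pos hc k
        have h2 : c ^ k * f (p - i) * (1 - f (p - i - 1)) = 1 := by
          rw [hfs]
          field_simp
        obtain ⟨m, rfl⟩ : ∃ m, k = m + 1 := ⟨k - 1, by omega⟩
        rw [Nat.add_sub_cancel, mul_pow (c * _), mul_pow c, pow_succ (f (p - i)), mul_pow]
        linear_combination -(t i ^ (m + 1)) ^ (m + 1) * f (p - i) ^ m * h2
    · simp [pathEdgeProd, hf, pathWeight]
  refine ⟨x, ?_, fun _ => rfl, ?_, ?_⟩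
  · rintro (a | ⟨i, j⟩)
    · exact hy a
    · exact mul_pos (htpos i i.2.le) (hs0 i j)
  · rintro ⟨i, j⟩
    have hd : 0 < 1 - f (p - i - 1) := by linarith [hp (p - i - 1) (by omega)]
    have hxij : x (Sum.inr (i, j)) = t i * s i j := rfl
    rw [incidentSum_attachPath_inr hk, hE i i.2.le, hxij]
    split_ifs with hj
    · have h1 := hs i j
      rw [if_pos hj, eq_div_iff hd.ne'] at h1
      have h2 : t (i + 1) = t i * s i j := by
        rw [hts i i.2]
        congr 2
        exact (Fin.ext hj).symm
      rw [hE (i + 1) i.2, h2, ← Nat.sub_sub, mul_pow]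
      linear_combination -c * t i ^ k * h1
    · have h1 := hs i j
      rw [if_neg hj, div_one] at h1
      rw [mul_pow, h1]
      ring
  · rw [hE 0 (Nat.zero_le p), Nat.sub_zero, ht0]

end

end Hypergraph

end

noncomputable section

namespace Hypergraph

/-! ### Rescaling an eigenvector on a pendant edge -/

section

variable {α : Type*} {G : Hypergraph α} {k : ℕ} {e : Set α}

lemma eq_of_degree_eq_one {a : α} (hdeg : G.degree a = 1) {s : Set α} (he : e ∈ E(G))
    (ha : a ∈ e) (hs : s ∈ E(G)) (has : a ∈ s) : s = e := by
  obtain ⟨t, ht⟩ := Set.ncard_eq_one.1 hdeg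
  have h1 : e ∈ ({t} : Set (Set α)) := ht ▸ ⟨he, ha⟩
  have h2 : s ∈ ({t} : Set (Set α)) := ht ▸ ⟨hs, has⟩
  rw [Set.mem_singleton_iff] at h1 h2
  rw [h1, h2]

/-- On a pendant edge at `w`, scale the entries by `a * b`, with a further factor `a` at `u` and a
further factor `b` at `v`; keep all other entries, including the one at `w`. The product over the
edge is then scaled by `(a * b) ^ k`. -/
def pendantScale (e : Set α) (w u v : α) (a b : ℝ) (z : α) : ℝ :=
  open scoped Classical in
  if z ∈ e ∧ z ≠ w then a * b * (if z = u then a else 1) * (if z = v then b else 1) else 1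

lemma pendantScale_pos (e : Set α) (w u v : α) {a b : ℝ} (ha : 0 < a) (hb : 0 < b) (z : α) :
    0 < pendantScale e w u v a b z := by
  unfold pendantScale
  split_ifs <;> positivity

lemma finprod_mul_pendantScale_of_ne {s : Set α} {w u v : α} (he : e ∈ E(G))
    (hdeg : ∀ z ∈ e, z ≠ w → G.degree z = 1) (hs : s ∈ E(G)) (hse : s ≠ e) (a b : ℝ) (x : α → ℝ) :
    ∏ᶠ z ∈ s, x z * pendantScale e w u v a b z = ∏ᶠ z ∈ s, x z := by
  refine finprod_mem_congr rfl fun z hz => ?_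
  rw [pendantScale, if_neg, mul_one]
  exact fun h => hse (eq_of_degree_eq_one (hdeg z h.1 h.2) he h.1 hs hz)

lemma incidentSum_mul_pendantScale_of_notMem {w u v : α} (he : e ∈ E(G))
    (hdeg : ∀ z ∈ e, z ≠ w → G.degree z = 1) (a b : ℝ) (x : α → ℝ) {z : α} (hz : z ∉ e) :
    G.incidentSum (fun z => x z * pendantScale e w u v a b z) z = G.incidentSum x z := by
  refine finsum_mem_congr rfl fun s hs => ?_
  exact finprod_mul_pendantScale_of_ne he hdeg hs.1 (fun h => hz (h ▸ hs.2)) a b x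

variable [Finite α]

lemma finprod_mem_pos {x : α → ℝ} (hx : ∀ a, 0 < x a) (s : Set α) : 0 < ∏ᶠ b ∈ s, x b := by
  rw [finprod_mem_eq_finite_toFinset_prod _ (Set.toFinite s)]
  exact Finset.prod_pos fun a _ => hx a

lemma incidentSum_eq_add {R : Type*} [CommSemiring R] (x : α → R) (he : e ∈ E(G)) {a : α}
    (ha : a ∈ e) : G.incidentSum x a =
      (∏ᶠ b ∈ e, x b) + ∑ᶠ s ∈ {s | s ∈ E(G) ∧ a ∈ s ∧ s ≠ e}, ∏ᶠ b ∈ s, x b := by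
  have h1 : {s | s ∈ E(G) ∧ a ∈ s} = insert e {s | s ∈ E(G) ∧ a ∈ s ∧ s ≠ e} := by
    ext s
    by_cases h : s = e
    · subst h; simp [he, ha]
    · simp only [Set.mem_insert_iff, h, false_or, Set.mem_ofPred_eq, ne_eq, not_false_eq_true,
        and_true]
  rw [incidentSum, h1, finsum_mem_insert _ (fun h => h.2.2 rfl) (Set.toFinite _)]

lemma incidentSum_eq_finprod_of_degree_eq_one {R : Type*} [CommSemiring R] (x : α → R) {a : α}
    (hdeg : G.degree a = 1) (he : e ∈ E(G)) (ha : a ∈ e) :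
    G.incidentSum x a = ∏ᶠ b ∈ e, x b := by
  have h1 : {s | s ∈ E(G) ∧ a ∈ s ∧ s ≠ e} = ∅ := by
    ext s
    simp only [Set.mem_ofPred_eq, Set.mem_empty_iff_false, iff_false]
    exact fun h => h.2.2 (eq_of_degree_eq_one hdeg he ha h.1 h.2.1)
  rw [incidentSum_eq_add x he ha, h1, finsum_mem_empty, add_zero]

lemma finprod_lt_incidentSum_of_two_le_degree {x : α → ℝ} (hx : ∀ a, 0 < x a) {w : α}
    (hdeg : 2 ≤ G.degree w) (he : e ∈ E(G)) (hw : w ∈ e) :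
    ∏ᶠ b ∈ e, x b < G.incidentSum x w := by
  rw [incidentSum_eq_add x he hw, lt_add_iff_pos_right,
    finsum_mem_eq_finite_toFinset_sum _ (Set.toFinite _)]
  refine Finset.sum_pos (fun s _ => finprod_mem_pos hx s) ?_
  obtain ⟨s, hs, hse⟩ := Set.exists_ne_of_one_lt_ncard (Nat.lt_of_succ_le hdeg) e
  exact ⟨s, (Set.Finite.mem_toFinset _).2 ⟨hs.1, hs.2, hse⟩⟩

lemma finprod_pendantScale (hek : e.encard = k) {w u v : α} (hw : w ∈ e) (hu : u ∈ e)
    (hv : v ∈ e) (huw : u ≠ w) (hvw : v ≠ w) (a b : ℝ) :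
    ∏ᶠ z ∈ e, pendantScale e w u v a b z = (a * b) ^ k := by
  classical
  have hcard : (Set.toFinite e).toFinset.card = k := by
    rw [(Set.toFinite e).encard_eq_coe_toFinset_card] at hek
    exact_mod_cast hek
  rw [finprod_mem_eq_finite_toFinset_prod _ (Set.toFinite e)]
  set s := (Set.toFinite e).toFinset with hs
  have hmem : ∀ z, z ∈ s ↔ z ∈ e := fun z => Set.Finite.mem_toFinset _
  have hws := (hmem w).2 hw
  have hk : 1 ≤ k := hcard ▸ Finset.card_pos.2 ⟨w, hws⟩
  have h1 : ∀ z ∈ s.erase w, pendantScale e w u v a b z =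
      a * b * (if z = u then a else 1) * (if z = v then b else 1) := fun z hz => by
    obtain ⟨h2, h3⟩ := Finset.mem_erase.1 hz
    rw [pendantScale, if_pos ⟨(hmem z).1 h3, h2⟩]
  rw [← Finset.mul_prod_erase _ _ hws, Finset.prod_congr rfl h1, Finset.prod_mul_distrib,
    Finset.prod_mul_distrib, Finset.prod_const, Finset.card_erase_of_mem hws, hcard,
    Finset.prod_ite_eq', Finset.prod_ite_eq', if_pos (Finset.mem_erase.2 ⟨huw, (hmem u).2 hu⟩),
    if_pos (Finset.mem_erase.2 ⟨hvw, (hmem v).2 hv⟩)]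
  have h4 : pendantScale e w u v a b w = 1 := by simp [pendantScale]
  obtain ⟨m, rfl⟩ : ∃ m, k = m + 1 := ⟨k - 1, by omega⟩
  rw [h4, Nat.add_sub_cancel]
  ring

lemma finprod_mul_pendantScale (hek : e.encard = k) {w u v : α} (hw : w ∈ e) (hu : u ∈ e)
    (hv : v ∈ e) (huw : u ≠ w) (hvw : v ≠ w) (a b : ℝ) (x : α → ℝ) :
    ∏ᶠ z ∈ e, x z * pendantScale e w u v a b z = (a * b) ^ k * ∏ᶠ z ∈ e, x z := by
  rw [finprod_mem_mul_distrib (Set.toFinite e), finprod_pendantScale hek hw hu hv huw hvw, mul_comm]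

lemma incidentSum_mul_pendantScale_self (hek : e.encard = k) {w u v : α} (he : e ∈ E(G))
    (hdeg : ∀ z ∈ e, z ≠ w → G.degree z = 1) (hw : w ∈ e) (hu : u ∈ e)
    (hv : v ∈ e) (huw : u ≠ w) (hvw : v ≠ w) (a b : ℝ) (x : α → ℝ) :
    G.incidentSum (fun z => x z * pendantScale e w u v a b z) w =
      G.incidentSum x w - (1 - (a * b) ^ k) * ∏ᶠ z ∈ e, x z := by
  rw [incidentSum_eq_add _ he hw, incidentSum_eq_add x he hw,
    finprod_mul_pendantScale hek hw hu hv huw hvw]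
  have h1 : ∑ᶠ s ∈ {s | s ∈ E(G) ∧ w ∈ s ∧ s ≠ e}, ∏ᶠ z ∈ s, x z * pendantScale e w u v a b z =
      ∑ᶠ s ∈ {s | s ∈ E(G) ∧ w ∈ s ∧ s ≠ e}, ∏ᶠ z ∈ s, x z :=
    finsum_mem_congr rfl fun s hs =>
      finprod_mul_pendantScale_of_ne he hdeg hs.1 hs.2.2 a b x
  rw [h1]
  ring

/-- If the vertices other than `w` of an edge `e` satisfy eigenvalue equations with weights `1 - f`
at `u`, `1 - g` at `v` and `1` elsewhere, multiplying them determines the proportion of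
`c * x w ^ k` contributed by `e`. -/
lemma finprod_eq_of_weighted_eigenvector (hek : e.encard = k) {w u v : α} (hw : w ∈ e)
    (hu : u ∈ e) (hv : v ∈ e) (huw : u ≠ w) (hvw : v ≠ w) (huv : u ≠ v) {c f g : ℝ}
    {x : α → ℝ} (hx : ∀ a, 0 < x a)
    (hxu : ∏ᶠ z ∈ e, x z = c * (1 - f) * x u ^ k) (hxv : ∏ᶠ z ∈ e, x z = c * (1 - g) * x v ^ k)
    (hxe : ∀ z ∈ e, z ≠ w → z ≠ u → z ≠ v → ∏ᶠ z ∈ e, x z = c * x z ^ k) :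
    x w ^ k = c ^ (k - 1) * ((1 - f) * (1 - g)) * ∏ᶠ z ∈ e, x z := by
  classical
  have hcard : (Set.toFinite e).toFinset.card = k := by
    rw [(Set.toFinite e).encard_eq_coe_toFinset_card] at hek
    exact_mod_cast hek
  have hpos := finprod_mem_pos hx e
  have hPdef := finprod_mem_eq_finite_toFinset_prod x (Set.toFinite e)
  set P := ∏ᶠ z ∈ e, x z with hP
  set s := (Set.toFinite e).toFinset with hs
  have hmem : ∀ z, z ∈ s ↔ z ∈ e := fun z => Set.Finite.mem_toFinset _
  have hws := (hmem w).2 hw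
  have hk : 1 ≤ k := hcard ▸ Finset.card_pos.2 ⟨w, hws⟩
  have h1 : ∀ z ∈ s.erase w, P =
      c * (if z = u then 1 - f else 1) * (if z = v then 1 - g else 1) * x z ^ k := fun z hz => by
    obtain ⟨h2, h3⟩ := Finset.mem_erase.1 hz
    by_cases hzu : z = u
    · subst hzu
      simpa [huv] using hxu
    · by_cases hzv : z = v
      · subst hzv
        simpa [hzu] using hxv
      · simpa [hzu, hzv] using hxe z ((hmem z).1 h3) h2 hzu hzv
  have h2 := Finset.prod_congr (rfl : s.erase w = s.erase w) h1
  rw [Finset.prod_mul_distrib, Finset.prod_mul_distrib, Finset.prod_mul_distrib, Finset.prod_const,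
    Finset.prod_const, Finset.card_erase_of_mem hws, hcard,
    Finset.prod_ite_eq', Finset.prod_ite_eq', if_pos (Finset.mem_erase.2 ⟨huw, (hmem u).2 hu⟩),
    if_pos (Finset.mem_erase.2 ⟨hvw, (hmem v).2 hv⟩), Finset.prod_pow] at h2
  have h3 : P ^ k = x w ^ k * (∏ z ∈ s.erase w, x z) ^ k := by
    rw [hPdef, ← Finset.mul_prod_erase _ _ hws, mul_pow]
  obtain ⟨m, rfl⟩ : ∃ m, k = m + 1 := ⟨k - 1, by omega⟩
  rw [Nat.add_sub_cancel] at h2 ⊢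
  refine mul_left_cancel₀ (pow_pos hpos m).ne' ?_
  calc P ^ m * x w ^ (m + 1) = c ^ m * (1 - f) * (1 - g) *
        (x w ^ (m + 1) * (∏ z ∈ s.erase w, x z) ^ (m + 1)) := by rw [h2]; ring
    _ = P ^ m * (c ^ m * ((1 - f) * (1 - g)) * P) := by rw [← h3]; ring

end

/-- The product `(1 - f p) * (1 - f q)` of the weights left for the pendant edge increases when the
path lengths `q + 1 ≤ p` are replaced by `q` and `p + 1`. By the recursion this amounts to
`t * (1 - t)` being larger at `f (p + 1)` than at `f (q + 1)`, which holds because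
`f (q + 1) < f (p + 1)` and `f (q + 1) + f (p + 1) < 1`. -/
lemma pathWeight_mul_lt {r : ℝ} (hr : 0 < r) {p q : ℕ} (hqp : q + 1 ≤ p)
    (hp : ∀ n ≤ p, pathWeight r n < 1)
    (hlt : r < (1 - pathWeight r p) * (1 - pathWeight r (q + 1))) :
    pathWeight r (p + 1) < 1 ∧ (1 - pathWeight r p) * (1 - pathWeight r (q + 1)) <
      (1 - pathWeight r (p + 1)) * (1 - pathWeight r q) := by
  have hp1 := hp p le_rfl
  have hq1 := hp q (by omega)
  have hfp0 := pathWeight_succ_pos hr hp1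
  have hfq0 := pathWeight_succ_pos hr hq1
  have hmono : pathWeight r (q + 1) < pathWeight r (p + 1) :=
    pathWeight_lt_pathWeight hr (by omega) fun l hl => hp l (by omega)
  have hep : pathWeight r (p + 1) * (1 - pathWeight r p) = r :=
    div_mul_cancel₀ _ (by linarith)
  have heq : pathWeight r (q + 1) * (1 - pathWeight r q) = r :=
    div_mul_cancel₀ _ (by linarith)
  have hsum : pathWeight r (p + 1) + pathWeight r (q + 1) < 1 := by
    have : pathWeight r (p + 1) < 1 - pathWeight r (q + 1) := by
      refine lt_of_mul_lt_mul_right ?_ (sub_pos.2 hp1).le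
      rw [hep]
      linarith
    linarith
  refine ⟨by linarith, ?_⟩
  generalize pathWeight r (p + 1) = a at *
  generalize pathWeight r (q + 1) = b at *
  have h1 : b * (1 - b) < a * (1 - a) := by nlinarith
  refine lt_of_mul_lt_mul_left ?_ (mul_pos hfp0 hfq0).le
  calc a * b * ((1 - pathWeight r p) * (1 - b)) = r * (b * (1 - b)) := by
        linear_combination b * (1 - b) * hep
    _ < r * (a * (1 - a)) := mul_lt_mul_of_pos_left h1 hr
    _ = a * b * ((1 - a) * (1 - pathWeight r q)) := by
        linear_combination -(a * (1 - a)) * heq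

end Hypergraph

end

noncomputable section

namespace Hypergraph

/-! ### Comparison of the two attachments -/

section

variable {α : Type*} {k : ℕ} {G : Hypergraph α} {u v : α}

lemma IsUniform.attachTwoPaths (hk : 3 ≤ k) (hG : G.IsUniform k) (p q : ℕ) :
    (G.attachTwoPaths k u v p q).IsUniform k :=
  (hG.attachPath hk).attachPath hk

lemma IsEdgeConnected.attachTwoPaths (hk : 3 ≤ k) (hG : G.IsEdgeConnected) (hu : u ∈ V(G))
    (hv : v ∈ V(G)) (p q : ℕ) : (G.attachTwoPaths k u v p q).IsEdgeConnected :=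
  (hG.attachPath hk hu).attachPath hk (inl_mem_vertexSet_attachPath hv)

variable [Finite α]

open scoped Classical in
lemma incidentSum_attachTwoPaths_inl_inl (hk : 3 ≤ k) {p q : ℕ}
    (x : (α ⊕ Fin p × Fin (k - 1)) ⊕ Fin q × Fin (k - 1) → ℝ) (z : α) :
    (G.attachTwoPaths k u v p q).incidentSum x (Sum.inl (Sum.inl z)) =
      G.incidentSum (fun b => x (Sum.inl (Sum.inl b))) z +
        (if z = u then pathEdgeProd hk u p (fun b => x (Sum.inl b)) 0 else 0) +
        if z = v then pathEdgeProd hk (Sum.inl v) q x 0 else 0 := by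
  rw [attachTwoPaths, incidentSum_attachPath_inl hk, incidentSum_attachPath_inl hk]
  simp only [Sum.inl.injEq]

lemma incidentSum_attachTwoPaths_inl_inr (hk : 3 ≤ k) {p q : ℕ}
    (x : (α ⊕ Fin p × Fin (k - 1)) ⊕ Fin q × Fin (k - 1) → ℝ) (b : Fin p × Fin (k - 1)) :
    (G.attachTwoPaths k u v p q).incidentSum x (Sum.inl (Sum.inr b)) =
      (G.attachPath k u p).incidentSum (fun b => x (Sum.inl b)) (Sum.inr b) := by
  classical
  rw [attachTwoPaths, incidentSum_attachPath_inl hk, if_neg (by simp), add_zero]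

/-- A positive eigenvector of `G_{u,v}(p,q)` restricts to a positive vector on `G` that satisfies
the eigenvalue equation weighted by `1 - f p` at `u` and `1 - f q` at `v`. -/
lemma exists_weighted_of_eigenvector (hk : 3 ≤ k) (huv : u ≠ v) (hu : u ∈ V(G)) (hv : v ∈ V(G))
    {p q : ℕ} {c : ℝ} (hc : 0 < c) {x : (α ⊕ Fin p × Fin (k - 1)) ⊕ Fin q × Fin (k - 1) → ℝ}
    (hx : ∀ b, 0 < x b) (hxc : ∀ b ∈ V(G.attachTwoPaths k u v p q),
      (G.attachTwoPaths k u v p q).incidentSum x b = c * x b ^ k) :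
    ∃ y : α → ℝ, (∀ a, 0 < y a) ∧ (∀ n < p, pathWeight (c ^ k)⁻¹ n < 1) ∧
      G.incidentSum y u = c * (1 - pathWeight (c ^ k)⁻¹ p) * y u ^ k ∧
      G.incidentSum y v = c * (1 - pathWeight (c ^ k)⁻¹ q) * y v ^ k ∧
      ∀ a ∈ V(G), a ≠ u → a ≠ v → G.incidentSum y a = c * y a ^ k := by
  classical
  obtain ⟨-, hEq⟩ := pathEdgeProd_eq_of_eigenvector hk (G.attachPath k u p) (u := Sum.inl v) hc hx
    fun b => hxc _ (inr_mem_vertexSet_attachPath b)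
  obtain ⟨hfp, hEp⟩ := pathEdgeProd_eq_of_eigenvector hk G (u := u) hc
    (x := fun b => x (Sum.inl b)) (fun b => hx _) fun b => by
      rw [← incidentSum_attachTwoPaths_inl_inr (v := v) hk x b]
      exact hxc _ (inl_mem_vertexSet_attachPath (inr_mem_vertexSet_attachPath b))
  have hG : ∀ a ∈ V(G), _ := fun a ha => (incidentSum_attachTwoPaths_inl_inl hk x a).symm.trans
    (hxc _ (inl_mem_vertexSet_attachPath (inl_mem_vertexSet_attachPath ha)))
  refine ⟨fun a => x (Sum.inl (Sum.inl a)), fun a => hx _, hfp, ?_, ?_, fun a ha hau hav => ?_⟩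
  · have h := hG u hu
    rw [if_pos rfl, if_neg huv, hEp] at h
    linear_combination h
  · have h := hG v hv
    rw [if_neg huv.symm, if_pos rfl, hEq] at h
    linear_combination h
  · have h := hG a ha
    rw [if_neg hau, if_neg hav] at h
    linear_combination h

/-- Conversely, a positive vector on `G` that satisfies the weighted eigenvalue equation as an
inequality, strict at some `w`, bounds the spectral radius of `G_{u,v}(p,q)`. -/
lemma spectralRadius_attachTwoPaths_lt {α : Type*} [Fintype α] {k : ℕ} {G : Hypergraph α}
    {u v : α} (hk : 3 ≤ k) (hG : G.IsUniform k)
    (hconn : G.IsEdgeConnected) (huv : u ≠ v) (hu : u ∈ V(G)) (hv : v ∈ V(G)) {p q : ℕ} {c : ℝ}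
    (hc : 0 < c) (hp : ∀ n < p, pathWeight (c ^ k)⁻¹ n < 1)
    (hq : ∀ n < q, pathWeight (c ^ k)⁻¹ n < 1) {y : α → ℝ} (hy : ∀ a, 0 < y a)
    (hyu : G.incidentSum y u ≤ c * (1 - pathWeight (c ^ k)⁻¹ p) * y u ^ k)
    (hyv : G.incidentSum y v ≤ c * (1 - pathWeight (c ^ k)⁻¹ q) * y v ^ k)
    (hyc : ∀ a ∈ V(G), a ≠ u → a ≠ v → G.incidentSum y a ≤ c * y a ^ k)
    {w : α} (hw : w ∈ V(G)) (hwu : w ≠ u) (hwv : w ≠ v) (hyw : G.incidentSum y w < c * y w ^ k) :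
    (G.attachTwoPaths k u v p q).spectralRadius k < c := by
  classical
  obtain ⟨x₁, hx₁, hx₁y, hx₁c, hE₁⟩ := exists_extension_attachPath hk G u hc hp hy
  obtain ⟨x, hx, hxx, hxc, hE⟩ :=
    exists_extension_attachPath hk (G.attachPath k u p) (Sum.inl v) hc hq hx₁
  have hxx' : (fun b => x (Sum.inl b)) = x₁ := funext hxx
  have hxy : (fun a => x (Sum.inl (Sum.inl a))) = y := funext fun a => by rw [hxx, hx₁y]
  have hS := fun a => incidentSum_attachTwoPaths_inl_inl (G := G) (u := u) (v := v) hk x a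
  rw [hxx', hxy, hE₁, hE, hx₁y] at hS
  have hxa : ∀ a, x (Sum.inl (Sum.inl a)) = y a := congrFun hxy
  refine spectralRadius_lt_of_incidentSum_le hk (hG.attachTwoPaths hk p q)
    (hconn.attachTwoPaths hk hu hv p q) hx ?_ (w := Sum.inl (Sum.inl w))
    (inl_mem_vertexSet_attachPath (inl_mem_vertexSet_attachPath hw)) ?_
  · intro b hb
    rcases mem_vertexSet_attachPath (inl_mem_vertexSet_attachPath hv) hb with
      ⟨b, hb', rfl⟩ | ⟨b, rfl⟩
    · rcases mem_vertexSet_attachPath hu hb' with ⟨a, ha, rfl⟩ | ⟨b, rfl⟩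
      · rw [hS, hxa]
        by_cases hau : a = u
        · subst hau
          rw [if_pos rfl, if_neg huv]
          linarith
        · by_cases hav : a = v
          · subst hav
            rw [if_neg hau, if_pos rfl]
            linarith
          · rw [if_neg hau, if_neg hav]
            linarith [hyc a ha hau hav]
      · rw [incidentSum_attachTwoPaths_inl_inr hk, hxx', hx₁c, hxx]
    · exact (hxc b).le
  · rw [hS, hxa, if_neg hwu, if_neg hwv]
    linarith

end

end Hypergraph

end

theorem lemma5 {α : Type*} [Fintype α] (k : ℕ) (hk : 3 ≤ k)
    (G : Hypergraph α) (hG : G.IsUniform k) (hconn : G.IsConnected)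
    (e : Set α) (he : G.IsPendantEdge e)
    (u v : α) (hu : u ∈ e) (hv : v ∈ e) (huv : u ≠ v)
    (hup : G.IsPendantVertex u) (hvp : G.IsPendantVertex v)
    (p q : ℕ) (hqp : q ≤ p) (hq : 1 ≤ q) :
    (G.attachTwoPaths k u v (p + 1) (q - 1)).spectralRadius k <
      (G.attachTwoPaths k u v p q).spectralRadius k := by
  obtain ⟨heE, w, hwe, hwdeg, hdeg⟩ := he
  obtain ⟨q, rfl⟩ : ∃ m, q = m + 1 := ⟨q - 1, by omega⟩
  rw [Nat.add_sub_cancel]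
  have hEC := hconn.isEdgeConnected
  have huV := hup.1
  have hvV := hvp.1
  have hwV : w ∈ V(G) := G.subset_vertexSet_of_mem_edgeSet' heE hwe
  have huw : u ≠ w := fun h => by
    have := hup.2
    rw [h] at this
    omega
  have hvw : v ≠ w := fun h => by
    have := hvp.2
    rw [h] at this
    omega
  have hek := hG e heE
  obtain ⟨c, X, hX, hXc, hcle⟩ := Hypergraph.exists_pos_eigenvector_le_spectralRadius hk
    (hG.attachTwoPaths hk (u := u) (v := v) p (q + 1))
    (hEC.attachTwoPaths hk huV hvV p (q + 1))
    ⟨_, Hypergraph.inl_mem_vertexSet_attachPath (Hypergraph.inl_mem_vertexSet_attachPath hwV)⟩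
  have hc : 0 < c := by
    classical
    have h1 := hXc (Sum.inl (Sum.inl w))
      (Hypergraph.inl_mem_vertexSet_attachPath (Hypergraph.inl_mem_vertexSet_attachPath hwV))
    rw [Hypergraph.incidentSum_attachTwoPaths_inl_inl hk, if_neg huw.symm, if_neg hvw.symm,
      add_zero, add_zero] at h1
    have h2 := (Hypergraph.finprod_mem_pos (fun a => hX (Sum.inl (Sum.inl a))) e).trans
      (Hypergraph.finprod_lt_incidentSum_of_two_le_degree
        (fun a => hX (Sum.inl (Sum.inl a))) hwdeg heE hwe)
    rw [h1] at h2
    exact pos_of_mul_pos_left h2 (pow_pos (hX _) k).le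
  refine lt_of_lt_of_le ?_ hcle
  obtain ⟨x, hx, hfp, hxu, hxv, hxc⟩ :=
    Hypergraph.exists_weighted_of_eigenvector hk huv huV hvV hc hX hXc
  have hr : 0 < (c ^ k)⁻¹ := inv_pos.2 (pow_pos hc k)
  have hPpos := Hypergraph.finprod_mem_pos hx e
  have hS1 := fun z hz hzw => Hypergraph.incidentSum_eq_finprod_of_degree_eq_one x
    (hdeg z hz hzw) heE hz
  have hSw := Hypergraph.finprod_lt_incidentSum_of_two_le_degree hx hwdeg heE hwe
  rw [hxc w hwV huw.symm hvw.symm] at hSw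
  rw [hS1 u hu huw] at hxu
  rw [hS1 v hv hvw] at hxv
  have hxe : ∀ z ∈ e, z ≠ w → z ≠ u → z ≠ v → ∏ᶠ z ∈ e, x z = c * x z ^ k :=
    fun z hz hzw hzu hzv => by
      rw [← hS1 z hz hzw]
      exact hxc z (G.subset_vertexSet_of_mem_edgeSet' heE hz) hzu hzv
  have hwk := Hypergraph.finprod_eq_of_weighted_eigenvector hek hwe hu hv huw hvw huv hx hxu hxv hxe
  generalize hP : ∏ᶠ z ∈ e, x z = P at *
  set f := Hypergraph.pathWeight (c ^ k)⁻¹ with hf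
  have hfp1 : f p < 1 := by
    rw [hxu] at hPpos
    have := pos_of_mul_pos_left (pos_of_mul_pos_left hPpos (pow_pos (hx u) k).le |>.trans_eq
      (mul_comm _ _)) hc.le
    linarith
  have hfle : ∀ n ≤ p, f n < 1 := fun n hn => by
    rcases hn.lt_or_eq with h | rfl
    · exact hfp n h
    · exact hfp1
  -- The vertex `w` lies on another edge, so that `e` accounts for less than all of `c * x w ^ k`.
  have hlt : (c ^ k)⁻¹ < (1 - f p) * (1 - f (q + 1)) := by
    rw [inv_lt_iff_one_lt_mul₀' (pow_pos hc k)]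
    refine lt_of_mul_lt_mul_right ?_ hPpos.le
    calc 1 * P = P := one_mul P
      _ < c * x w ^ k := hSw
      _ = c ^ k * ((1 - f p) * (1 - f (q + 1))) * P := by
        rw [hwk, ← mul_assoc, ← mul_assoc, ← pow_succ', Nat.sub_add_cancel (by omega)]
  obtain ⟨hfp2, hbal⟩ := Hypergraph.pathWeight_mul_lt hr hqp hfle hlt
  have hA := sub_pos.2 hfp1
  have hB := sub_pos.2 (hfle (q + 1) hqp)
  have hA' := sub_pos.2 hfp2
  have hB' := sub_pos.2 (hfle q (by omega))
  -- These factors turn the weights of the old equations at `u` and `v` into the new ones.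
  obtain ⟨a, ha, hak⟩ := Hypergraph.exists_pos_pow_eq (show k ≠ 0 by omega) (div_pos hA hA')
  obtain ⟨b, hb, hbk⟩ := Hypergraph.exists_pos_pow_eq (show k ≠ 0 by omega) (div_pos hB hB')
  rw [eq_div_iff hA'.ne'] at hak
  rw [eq_div_iff hB'.ne'] at hbk
  have hab : (a * b) ^ k < 1 := by
    refine lt_of_mul_lt_mul_right ?_ (mul_pos hA' hB').le
    rw [one_mul, mul_pow]
    calc a ^ k * b ^ k * ((1 - f (p + 1)) * (1 - f q)) = (1 - f p) * (1 - f (q + 1)) := by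
          rw [← hak, ← hbk]; ring
      _ < _ := hbal
  have hSe : ∀ z ∈ e, z ≠ w → G.incidentSum
      (fun z => x z * Hypergraph.pendantScale e w u v a b z) z = (a * b) ^ k * P :=
    fun z hz hzw => by
      rw [Hypergraph.incidentSum_eq_finprod_of_degree_eq_one _ (hdeg z hz hzw) heE hz,
        Hypergraph.finprod_mul_pendantScale hek hwe hu hv huw hvw, hP]
  have hSw' := Hypergraph.incidentSum_mul_pendantScale_self hek heE hdeg hwe hu hv huw hvw a b x
  rw [hP, hxc w hwV huw.symm hvw.symm] at hSw'
  have hscale : ∀ z, z ∉ e ∨ z = w → Hypergraph.pendantScale e w u v a b z = 1 := fun z hz => by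
    rw [Hypergraph.pendantScale, if_neg]
    exact fun h => hz.elim (fun h' => h' h.1) h.2
  have hw_lt : G.incidentSum (fun z => x z * Hypergraph.pendantScale e w u v a b z) w <
      c * (x w * Hypergraph.pendantScale e w u v a b w) ^ k := by
    rw [hSw', hscale w (Or.inr rfl), mul_one]
    have := mul_pos (sub_pos.2 hab) hPpos
    linarith
  refine Hypergraph.spectralRadius_attachTwoPaths_lt hk hG hEC huv huV hvV hc
    (fun n hn => hfle n (by omega)) (fun n hn => hfle n (by omega))
    (y := fun z => x z * Hypergraph.pendantScale e w u v a b z)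
    (fun z => mul_pos (hx z) (Hypergraph.pendantScale_pos e w u v ha hb z)) ?_ ?_ ?_ hwV
    huw.symm hvw.symm hw_lt
  · rw [hSe u hu huw, Hypergraph.pendantScale, if_pos ⟨hu, huw⟩, if_pos rfl, if_neg huv, mul_one,
      mul_pow (x u), mul_pow (a * b) a, hxu]
    refine le_of_eq ?_
    linear_combination -(c * x u ^ k * (a * b) ^ k) * hak
  · rw [hSe v hv hvw, Hypergraph.pendantScale, if_pos ⟨hv, hvw⟩, if_neg huv.symm, if_pos rfl,
      mul_one, mul_pow (x v), mul_pow (a * b) b, hxv]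
    refine le_of_eq ?_
    linear_combination -(c * x v ^ k * (a * b) ^ k) * hbk
  · intro z hz hzu hzv
    by_cases hze : z ∈ e
    · by_cases hzw : z = w
      · subst hzw
        exact hw_lt.le
      · rw [hSe z hze hzw, Hypergraph.pendantScale, if_pos ⟨hze, hzw⟩, if_neg hzu, if_neg hzv,
          mul_one, mul_one, mul_pow, hxe z hze hzw hzu hzv]
        exact le_of_eq (by ring)
    · rw [Hypergraph.incidentSum_mul_pendantScale_of_notMem heE hdeg a b x hze,
        hscale z (Or.inl hze), mul_one, hxc z hz hzu hzv]
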